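/- **Conventions.** A generic front of an oriented Legendrian link $l$ in $(\mathbb R^3,\ker(du-p\,dq))$ is a plane curve in the $(q,u)$-plane, without vertical tangents, with transverse double points and with cusps pointing leftward or rightward; it is considered up to the combinatorial type of such pictures. Its *morsification* is the link diagram in which at each crossing the branch of larger slope passes over, each left cusp is rounded, and each right cusp is replaced by a positive curl (writhe $+1$). If $w$ denotes the writhe, $tb(l)=-w(\text{morsification})$. $R$ is the regular isotopy invariant of oriented link diagrams, with values in $\mathbb Z[z^{\pm1},a^{\pm1}]$, determined by: the circle has value $\frac{a-a^{-1}}{z}$ (and the empty diagram has value $1$); $R(K_+)-R(K_-)=z\,R(K_0)$, where $K_+,K_-,K_0$ differ only near one crossing, which is positive, negative, and smoothed according to the orientation; adding a curl of sign $\pm1$ multiplies $R$ by $a^{\pm1}$. $D$ is the regular isotopy invariant of unoriented link diagrams determined by: the circle has value $\frac{a-a^{-1}}{z}+1$ (and the empty diagram $1$); $D(K_1)-D(K_2)=z\,(D(K_V)-D(K_H))$, where the four diagrams differ only near one crossing, at which in $K_1$ the branch of positive slope is over, in $K_2$ the branch of negative slope is over, in $K_V$ the crossing is replaced by two arcs $)\,($,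 and in $K_H$ by two horizontal arcs, one above the other; adding a curl of sign $\pm1$ multiplies $D$ by $a^{\pm1}$. The Kauffman polynomial is $Y=a^{-w}D$. For a front, $R(l)$, $D(l)$, $Y(l)$ are the values on its morsification, and $e_Y(l)$ is the least exponent of $a$ in $Y(l)$. A *state* $\sigma$ of the (unoriented) front of $l$ is an oriented front $l_\sigma$ obtained by keeping each crossing, or splicing it horizontally (into two horizontal strands, one above the other), or splicing it vertically (into a right cusp followed by a left cusp), and then choosing an orientation. Its weight $[l,\sigma]$ is the product over the crossings of local weights: $1$ for a kept crossing; $ta^{-2}(t-t^{-1})$ for a vertical splicing whose new right cusp is oriented downward and whose new left cusp is oriented upward; $t^{-1}-t$ for a horizontal splicing whose lower strand runs leftward and whose upper strand runs rightward; $0$ otherwise. Let $c(\sigma)$ be the number of left cusps of $l_\sigma$ oriented upward plus the number of right cusps of $l_\sigma$ oriented downward. The contribution of $\sigma$ (to the right side of the Legendrian Jaeger formula for $D(l)(t-t^{-1},a^2t^{-1})$) is $$(at^{-1})^{c(\sigma)}\,[l,\sigma]\,R(l_\sigma)(t-t^{-1},a),$$ a Laurent polynomial in $a$ with coefficients in $\mathbb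 Q(t)$. **Statement.** Let $l$ be an oriented Legendrian link (in particular, a Legendrian knot) given by a generic front. Then 1. for every state $\sigma$ of the front of $l$, the contribution of $\sigma$ is a genuine polynomial in $a$, that is, it contains no negative power of $a$; 2. $D(l)$ is a genuine polynomial in $a$, that is, it contains no negative power of $a$; 3. $tb(l)\le e_Y(l)$. -/

import Mathlib

open scoped LaurentPolynomial

noncomputable section

/-! ### Sliced plane diagrams

Diagrams are read from left to right and cut by vertical lines into elementary pieces.  A generic
vertical line meets the diagram in finitely many strands, listed from bottom to top. -/

/-- Labels carried by strands.  `Bool` is used for oriented diagrams (`true`: the strand runs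
rightward, `false`: leftward), `Unit` for unoriented ones.  `rev` reverses the direction. -/
class Direction (α : Type) where
  rev : α → α
  rev_rev : ∀ x, rev (rev x) = x

instance : Direction Bool := ⟨Bool.not, Bool.not_not⟩

instance : Direction Unit := ⟨id, fun _ => rfl⟩

open Direction

/-- The elementary pieces.
* `birth o`: a turn (or a cusp) pointing leftward, at which two neighbouring strands begin, the
  lower one with label `o`, the upper one with label `rev o`;
* `death`: a turn (or a cusp) pointing rightward, at which two neighbouring strands end;
* `cross c`: two neighbouring strands cross; `c` tells which one is over, if that is recorded. -/
inductive Piece (κ α : Type) : Type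
  | birth (o : α)
  | death
  | cross (c : κ)

/-- A sliced diagram, as the list from left to right of its pieces; each piece comes with the number
of strands that pass below it. -/
abbrev Word (κ α : Type) := List (ℕ × Piece κ α)

/-- Effect of a piece on the strands, when it sits at the bottom. -/
def Piece.act {κ α : Type} [DecidableEq α] [Direction α] : Piece κ α → List α → Option (List α)
  | .birth o, s => some (o :: rev o :: s)
  | .death, x :: y :: s => if y = rev x then some s else none
  | .cross _, x :: y :: s => some (y :: x :: s)
  | _, _ => none

/-- Effect of a piece that has `k` strands below it. -/
def Piece.actAt {κ α : Type} [DecidableEq α] [Direction α] (p : Piece κ α) :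
    ℕ → List α → Option (List α)
  | 0, s => p.act s
  | _ + 1, [] => none
  | k + 1, x :: s => (p.actAt k s).map (x :: ·)

/-- The strands to the right of the word, given the strands to its left (`none` if the pieces do not
fit together). -/
def Word.run {κ α : Type} [DecidableEq α] [Direction α] : Word κ α → List α → Option (List α)
  | [], s => some s
  | (k, p) :: w, s => (p.actAt k s).bind (Word.run w)

/-- A closed sliced diagram: it starts and ends with no strand. -/
def ClosedWord (κ α : Type) [DecidableEq α] [Direction α] : Type :=
  {w : Word κ α // Word.run w [] = some []}

/-- Link diagrams: regular projections with over/under information.  A crossing has type `true` when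
the strand of positive slope (joining the lower left end to the upper right end) is over, and type
`false` when the strand of negative slope is over.  `LinkDiagram Bool` are the oriented diagrams,
`LinkDiagram Unit` the unoriented ones. -/
abbrev LinkDiagram (α : Type) [DecidableEq α] [Direction α] := ClosedWord Bool α

/-- Generic fronts of Legendrian links in the plane with horizontal coordinate `q` and vertical
coordinate `u`: `birth` is a cusp pointing leftward, `death` a cusp pointing rightward, and crossings
carry no information.  `Front Bool` are the oriented fronts, `Front Unit` the unoriented ones. -/
abbrev Front (α : Type) [DecidableEq α] [Direction α] := ClosedWord Unit α

/-! ### Regular isotopy -/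

def Piece.ins {κ α : Type} : Piece κ α → ℕ
  | .birth _ => 0
  | .death => 2
  | .cross _ => 2

def Piece.outs {κ α : Type} : Piece κ α → ℕ
  | .birth _ => 2
  | .death => 0
  | .cross _ => 2

/-- The local moves that generate regular isotopy of sliced diagrams: the first five come from
isotopies of the plane, the last two are the second and the third Reidemeister moves. -/
inductive LocalMove {α : Type} : Word Bool α → Word Bool α → Prop
  | far (e f : Piece Bool α) (k m : ℕ) :
      LocalMove [(k, e), (k + e.outs + m, f)] [(k + e.ins + m, f), (k, e)]
  | zigzag (k : ℕ) (o : α) : LocalMove [(k, .birth o), (k + 1, .death)] []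
  | zagzig (k : ℕ) (o : α) : LocalMove [(k + 1, .birth o), (k, .death)] []
  | slideBirth (k : ℕ) (o : α) (c : Bool) :
      LocalMove [(k, .birth o), (k + 1, .cross c)] [(k + 1, .birth o), (k, .cross !c)]
  | slideDeath (k : ℕ) (c : Bool) :
      LocalMove [(k + 1, .cross c), (k, .death)] [(k, .cross !c), (k + 1, .death)]
  | reidemeister2 (k : ℕ) (c : Bool) : LocalMove [(k, .cross c), (k, .cross !c)] []
  | reidemeister3 (k : ℕ) (c : Bool) :
      LocalMove [(k, .cross c), (k + 1, .cross c), (k, .cross c)]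
        [(k + 1, .cross c), (k, .cross c), (k + 1, .cross c)]

/-- Regular isotopy of diagrams (the first Reidemeister move is not allowed). -/
def RegularIsotopic {α : Type} [DecidableEq α] [Direction α] :
    LinkDiagram α → LinkDiagram α → Prop :=
  Relation.EqvGen fun K L => ∃ u v x y, LocalMove x y ∧ K.1 = u ++ x ++ v ∧ L.1 = u ++ y ++ v

/-! ### The polynomials `R` and `D`

Laurent polynomials in `a` with coefficients in `ℤ[z, z⁻¹]`. -/

abbrev Laurent2 := (ℤ[T;T⁻¹])[T;T⁻¹]

/-- `aPow n = a ^ n`. -/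
def aPow (n : ℤ) : Laurent2 := LaurentPolynomial.T n

/-- `zPow n = z ^ n`. -/
def zPow (n : ℤ) : Laurent2 := LaurentPolynomial.C (LaurentPolynomial.T n)

/-- `Kink c x`: `x` is a horizontal strand at height `k` with a small curl, above or below the strand.
In both cases the two branches at the crossing run rightward or both leftward, so that the curl is
positive for `c = false` and negative for `c = true`. -/
inductive Kink {α : Type} (c : Bool) : Word Bool α → Prop
  | above (k : ℕ) (o : α) : Kink c [(k + 1, .birth o), (k, .cross c), (k + 1, .death)]
  | below (k : ℕ) (o : α) : Kink c [(k, .birth o), (k + 1, .cross c), (k, .death)]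

/-- Oriented words that agree except near a crossing, which is positive in the first one, negative
in the second one, and smoothed according to the orientation in the third one. -/
inductive SkeinTriple : Word Bool Bool → Word Bool Bool → Word Bool Bool → Prop
  | parallel (u v : Word Bool Bool) (p t : List Bool) (x : Bool)
      (h : Word.run u [] = some (p ++ x :: x :: t)) :
      SkeinTriple (u ++ [(p.length, .cross false)] ++ v) (u ++ [(p.length, .cross true)] ++ v)
        (u ++ v)
  | antiparallel (u v : Word Bool Bool) (p t : List Bool) (x : Bool)
      (h : Word.run u [] = some (p ++ x :: (!x) :: t)) :
      SkeinTriple (u ++ [(p.length, .cross true)] ++ v) (u ++ [(p.length, .cross false)] ++ v)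
        (u ++ [(p.length, .death), (p.length, .birth (!x))] ++ v)

/-- The defining properties of the regular isotopy invariant `R` of oriented diagrams. -/
structure IsHomflyR (R : LinkDiagram Bool → Laurent2) : Prop where
  regular : ∀ K L, RegularIsotopic K L → R K = R L
  empty : ∀ K : LinkDiagram Bool, K.1 = [] → R K = 1
  circle : ∀ (K : LinkDiagram Bool) (o : Bool), K.1 = [(0, .birth o), (0, .death)] →
    R K = (aPow 1 - aPow (-1)) * zPow (-1)
  skein : ∀ K₁ K₂ K₀ : LinkDiagram Bool, SkeinTriple K₁.1 K₂.1 K₀.1 →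
    R K₁ - R K₂ = zPow 1 * R K₀
  kink : ∀ (K L : LinkDiagram Bool) (c : Bool) (u x v : Word Bool Bool), Kink c x →
    K.1 = u ++ x ++ v → L.1 = u ++ v → R K = aPow (if c then -1 else 1) * R L

/-- The defining properties of the regular isotopy invariant `D` of unoriented diagrams. -/
structure IsKauffmanD (D : LinkDiagram Unit → Laurent2) : Prop where
  regular : ∀ K L, RegularIsotopic K L → D K = D L
  empty : ∀ K : LinkDiagram Unit, K.1 = [] → D K = 1
  circle : ∀ K : LinkDiagram Unit, K.1 = [(0, .birth ()), (0, .death)] →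
    D K = (aPow 1 - aPow (-1)) * zPow (-1) + 1
  skein : ∀ (K₁ K₂ KV KH : LinkDiagram Unit) (u v : Word Bool Unit) (k : ℕ),
    K₁.1 = u ++ [(k, .cross true)] ++ v → K₂.1 = u ++ [(k, .cross false)] ++ v →
    KV.1 = u ++ [(k, .death), (k, .birth ())] ++ v → KH.1 = u ++ v →
    D K₁ - D K₂ = zPow 1 * (D KV - D KH)
  kink : ∀ (K L : LinkDiagram Unit) (c : Bool) (u x v : Word Bool Unit), Kink c x →
    K.1 = u ++ x ++ v → L.1 = u ++ v → D K = aPow (if c then -1 else 1) * D L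

open Classical in
/-- The invariant `R` determined by its skein relations. -/
def homflyR : LinkDiagram Bool → Laurent2 :=
  if h : ∃ R, IsHomflyR R then h.choose else 0

open Classical in
/-- The invariant `D` determined by its skein relations. -/
def kauffmanD : LinkDiagram Unit → Laurent2 :=
  if h : ∃ D, IsKauffmanD D then h.choose else 0

/-! ### Forgetting orientations, morsification -/

def Piece.forget {κ α : Type} : Piece κ α → Piece κ Unit
  | .birth _ => .birth ()
  | .death => .death
  | .cross c => .cross c

def Word.forget {κ α : Type} (w : Word κ α) : Word κ Unit := w.map fun e => (e.1, e.2.forget)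

theorem Piece.forget_actAt {κ α : Type} [DecidableEq α] [Direction α] (p : Piece κ α) (k : ℕ)
    (s s' : List α) (h : p.actAt k s = some s') :
    p.forget.actAt k (s.map fun _ => ()) = some (s'.map fun _ => ()) := by
  induction k generalizing s s' with
  | zero =>
    rcases p with o | _ | c <;> rcases s with _ | ⟨x, _ | ⟨y, s⟩⟩ <;>
      simp_all [Piece.actAt, Piece.act, Piece.forget] <;>
      (obtain ⟨_, rfl⟩ := h; rfl)
  | succ k ih =>
    rcases s with _ | ⟨x, s⟩
    · simp [Piece.actAt] at h
    · simp only [Piece.actAt, Option.map_eq_some_iff] at h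
      obtain ⟨r, hr, rfl⟩ := h
      have := ih s r hr
      simp only [List.map_cons, Piece.actAt, this, Option.map_some]

theorem Word.forget_run {κ α : Type} [DecidableEq α] [Direction α] (w : Word κ α)
    (s s' : List α) (h : Word.run w s = some s') :
    Word.run w.forget (s.map fun _ => ()) = some (s'.map fun _ => ()) := by
  induction w generalizing s with
  | nil => simp_all [Word.run, Word.forget]
  | cons e w ih =>
    obtain ⟨k, p⟩ := e
    simp only [Word.run, Option.bind_eq_some_iff] at h
    obtain ⟨r, hr, hw⟩ := h
    have := ih r hw
    simp only [Word.forget] at this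
    simp only [Word.run, Word.forget, List.map_cons, p.forget_actAt k s r hr, Option.bind_some, this]

/-- The diagram or front with its orientation forgotten. -/
def ClosedWord.forget {κ α : Type} [DecidableEq α] [Direction α] (K : ClosedWord κ α) :
    ClosedWord κ Unit :=
  ⟨K.1.forget, Word.forget_run K.1 [] [] K.2⟩

/-- At crossings the strand of positive slope goes over, left cusps are rounded, and right cusps are
replaced by a positive curl. -/
def Piece.morsify {α : Type} (k : ℕ) : Piece Unit α → Word Bool α
  | .birth o => [(k, .birth o)]
  | .death => [(k, .cross true), (k, .death)]
  | .cross _ => [(k, .cross true)]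

def Word.morsify {α : Type} (w : Word Unit α) : Word Bool α := w.flatMap fun e => e.2.morsify e.1

theorem Word.run_append {κ α : Type} [DecidableEq α] [Direction α] (w w' : Word κ α)
    (s : List α) : Word.run (w ++ w') s = (Word.run w s).bind (Word.run w') := by
  induction w generalizing s with
  | nil => rfl
  | cons e w ih =>
    obtain ⟨k, p⟩ := e
    simp only [List.cons_append, Word.run, Option.bind_assoc]
    congr 1
    funext r
    exact ih r

theorem Piece.morsify_run {α : Type} [DecidableEq α] [Direction α] (p : Piece Unit α) (k : ℕ)
    (s s' : List α) (h : p.actAt k s = some s') : Word.run (p.morsify k) s = some s' := by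
  induction k generalizing s s' with
  | zero =>
    rcases p with o | _ | c <;> rcases s with _ | ⟨x, _ | ⟨y, s⟩⟩ <;>
      simp_all [Piece.actAt, Piece.act, Piece.morsify, Word.run, rev_rev]
  | succ k ih =>
    rcases s with _ | ⟨x, s⟩
    · simp [Piece.actAt] at h
    · simp only [Piece.actAt, Option.map_eq_some_iff] at h
      obtain ⟨r, hr, rfl⟩ := h
      have := ih s r hr
      rcases p with o | _ | c <;>
        simp [Piece.morsify, Word.run, Piece.actAt, Option.bind_eq_some_iff] at this ⊢ <;>
        exact this

theorem Word.morsify_run {α : Type} [DecidableEq α] [Direction α] (w : Word Unit α)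
    (s s' : List α) (h : Word.run w s = some s') : Word.run w.morsify s = some s' := by
  induction w generalizing s with
  | nil => simpa [Word.run, Word.morsify] using h
  | cons e w ih =>
    obtain ⟨k, p⟩ := e
    simp only [Word.run, Option.bind_eq_some_iff] at h
    obtain ⟨r, hr, hw⟩ := h
    have := ih r hw
    simp only [Word.morsify] at this
    simp [Word.morsify, Word.run_append, p.morsify_run k s r hr, this]

/-- The morsification of a front. -/
def Front.morsify {α : Type} [DecidableEq α] [Direction α] (l : Front α) : LinkDiagram α :=
  ⟨Word.morsify l.1, Word.morsify_run l.1 [] [] l.2⟩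

/-! ### Writhe, Bennequin invariant, `e_Y` -/

/-- Sign of a crossing; `s` lists the strands just left of the piece, from its height upward.  A
crossing of type `true` is positive exactly when one branch runs rightward and the other one
leftward. -/
def Piece.sign : Piece Bool Bool → List Bool → ℤ
  | .cross c, x :: y :: _ => if c = (x != y) then 1 else -1
  | _, _ => 0

/-- Sum of the signs of the crossings, when `s` lists the strands to the left of the word. -/
def Word.signSum : Word Bool Bool → List Bool → ℤ
  | [], _ => 0
  | (k, p) :: w, s => p.sign (s.drop k) + Word.signSum w ((p.actAt k s).getD [])

/-- The writhe of an oriented diagram. -/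
def writhe (K : LinkDiagram Bool) : ℤ := Word.signSum K.1 []

/-- The Bennequin invariant of the Legendrian link with a given front. -/
def tb (l : Front Bool) : ℤ := -writhe l.morsify

/-- The Kauffman polynomial `Y = a ^ (-w) D`. -/
def kauffmanY (K : LinkDiagram Bool) : Laurent2 := aPow (-writhe K) * kauffmanD K.forget

/-- The least exponent of `a` (`⊤` for the zero polynomial). -/
def leastExponent {A : Type} [Semiring A] (f : A[T;T⁻¹]) : WithTop ℤ := f.coeff.support.min

/-- The least exponent of `a` in the Kauffman polynomial of the Legendrian link. -/
def eY (l : Front Bool) : WithTop ℤ := leastExponent (kauffmanY l.morsify)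

/-- The Laurent polynomial in `a` has no negative powers of `a`. -/
def IsGenuinePolynomial {A : Type} [Semiring A] (f : A[T;T⁻¹]) : Prop :=
  ∃ p : Polynomial A, Polynomial.toLaurent p = f

/-! ### States -/

/-- What a state does with the pieces of an unoriented front: it orients the left cusps, keeps each
crossing, or splices it horizontally into two strands, or vertically into a right cusp followed by a
left cusp (whose lower branch gets the direction `o`). -/
inductive StatePiece : Type
  | leftCusp (o : Bool)
  | rightCusp
  | keep
  | horizontal
  | vertical (o : Bool)

/-- The piece of the original front. -/
def StatePiece.source : StatePiece → Piece Unit Unit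
  | .leftCusp _ => .birth ()
  | .rightCusp => .death
  | .keep => .cross ()
  | .horizontal => .cross ()
  | .vertical _ => .cross ()

/-- The corresponding part of the spliced front. -/
def StatePiece.target (k : ℕ) : StatePiece → Word Unit Bool
  | .leftCusp o => [(k, .birth o)]
  | .rightCusp => [(k, .death)]
  | .keep => [(k, .cross ())]
  | .horizontal => []
  | .vertical o => [(k, .death), (k, .birth o)]

/-- A state of a front: a choice of splicings and an orientation of the resulting front. -/
structure State (l : Front Unit) where
  pieces : List (ℕ × StatePiece)
  source_eq : (pieces.map fun e => (e.1, e.2.source)) = l.1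
  closed : Word.run (pieces.flatMap fun e => e.2.target e.1) [] = some []

/-- The spliced, oriented front `l_σ`. -/
def State.front {l : Front Unit} (σ : State l) : Front Bool :=
  ⟨σ.pieces.flatMap fun e => e.2.target e.1, σ.closed⟩

/-- The number of left cusps oriented upward plus the number of right cusps oriented downward; at
both, the lower branch runs leftward. -/
def Word.cuspCount : Word Unit Bool → List Bool → ℕ
  | [], _ => 0
  | (k, p) :: w, s =>
    (match p, s.drop k with
      | .birth false, _ => 1
      | .death, false :: _ => 1
      | _, _ => 0) + Word.cuspCount w ((p.actAt k s).getD [])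

/-- The variable `t`; coefficients of the Jaeger formula lie in the field `ℚ(t)`. -/
def tVar : RatFunc ℚ := RatFunc.X

theorem tVar_sub_inv_ne_zero : tVar - tVar⁻¹ ≠ 0 := by
  intro h
  have h0 : (RatFunc.X : RatFunc ℚ) ≠ 0 := RatFunc.X_ne_zero
  have h1 : (RatFunc.X : RatFunc ℚ) * RatFunc.X = 1 := by
    have h2 : (RatFunc.X : RatFunc ℚ) = RatFunc.X⁻¹ := sub_eq_zero.mp h
    nth_rewrite 2 [h2]
    exact mul_inv_cancel₀ h0
  have h3 : (Polynomial.X * Polynomial.X : Polynomial ℚ) = 1 := by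
    apply RatFunc.algebraMap_injective ℚ
    simpa [RatFunc.algebraMap_X] using h1
  have h4 := congrArg Polynomial.natDegree h3
  simp at h4

/-- The substitution `z = t - t⁻¹` in coefficients. -/
def substZ : ℤ[T;T⁻¹] →+* RatFunc ℚ :=
  LaurentPolynomial.eval₂ (Int.castRingHom (RatFunc ℚ)) (Units.mk0 _ tVar_sub_inv_ne_zero)

/-- `f(z, a) ↦ f(t - t⁻¹, a)`. -/
def Laurent2.subst : Laurent2 →+* (RatFunc ℚ)[T;T⁻¹] :=
  LaurentPolynomial.eval₂ (LaurentPolynomial.C.comp substZ)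
    ⟨LaurentPolynomial.T 1, LaurentPolynomial.T (-1), by
      rw [← LaurentPolynomial.T_add]; simp, by
      rw [← LaurentPolynomial.T_add]; simp⟩

/-- Local weight; `s` lists the strands of the spliced front just left of the piece, from its height
upward.  A vertical splicing has nonzero weight if the new right cusp is oriented downward and the
new left cusp upward, a horizontal one if the lower strand runs leftward and the upper strand
rightward. -/
def StatePiece.weight : StatePiece → List Bool → (RatFunc ℚ)[T;T⁻¹]
  | .vertical false, false :: true :: _ =>
      LaurentPolynomial.C (tVar * (tVar - tVar⁻¹)) * LaurentPolynomial.T (-2)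
  | .vertical _, _ => 0
  | .horizontal, false :: true :: _ => LaurentPolynomial.C (tVar⁻¹ - tVar)
  | .horizontal, _ => 0
  | _, _ => 1

def weightProd : List (ℕ × StatePiece) → List Bool → (RatFunc ℚ)[T;T⁻¹]
  | [], _ => 1
  | (k, p) :: w, s =>
    p.weight (s.drop k) * weightProd w ((Word.run (p.target k) s).getD [])

/-- The weight `[l, σ]` of a state. -/
def State.weight {l : Front Unit} (σ : State l) : (RatFunc ℚ)[T;T⁻¹] := weightProd σ.pieces []

/-- The contribution of the state `σ` to the right side of the Legendrian Jaeger formula: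
`(a t⁻¹) ^ (number of upward left cusps and downward right cusps of l_σ) [l, σ] R(l_σ)(t - t⁻¹, a)`. -/
def State.contribution {l : Front Unit} (σ : State l) : (RatFunc ℚ)[T;T⁻¹] :=
  (LaurentPolynomial.C tVar⁻¹ * LaurentPolynomial.T 1) ^ Word.cuspCount σ.front.1 [] *
    σ.weight * Laurent2.subst (homflyR σ.front.morsify)

end

/-!
The value of a skein invariant on a front is `a ^ (number of right cusps)` times its value on the
diagram in which all cusps are rounded. Induct on the number of left cusps and crossings: the last
left cusp is pulled to the right, past the strands that it meets, until it takes part in a zigzag, a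
circle, a curl or a double crossing, each of which reduces to simpler fronts. The coefficients of
these reductions contain no negative powers of `a`, because the only such power comes from the value
`(a - a⁻¹) / z` of a circle, whose right cusp contributes a factor `a`. The contributions of states
follow since the factor `a⁻²` of a vertical splicing is compensated by the two cusps it creates.
-/

noncomputable section

open Direction Word

section

variable {κ α : Type} [DecidableEq α] [Direction α]

/-! ### Strands -/

theorem Piece.actAt_length_add (p : Piece κ α) (b s : List α) (n : ℕ) :
    p.actAt (b.length + n) (b ++ s) = (p.actAt n s).map (b ++ ·) := by
  induction b with
  | nil => simp
  | cons x b ih =>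
    rw [List.length_cons, Nat.add_right_comm]
    simp only [List.cons_append, actAt, ih, Option.map_map]
    rfl

theorem Piece.actAt_length (p : Piece κ α) (b s : List α) :
    p.actAt b.length (b ++ s) = (p.act s).map (b ++ ·) :=
  p.actAt_length_add b s 0

theorem Piece.actAt_of_length_lt (p : Piece κ α) {k : ℕ} {s : List α} (h : s.length < k) :
    p.actAt k s = none := by
  induction s generalizing k with
  | nil => obtain _ | k := k <;> simp_all [actAt]
  | cons x s ih =>
    obtain _ | k := k
    · simp at h
    · simp [actAt, ih (by simpa using h)]

theorem Piece.actAt_eq_some_iff {p : Piece κ α} {k : ℕ} {s r : List α} :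
    p.actAt k s = some r ↔
      ∃ b t t', b.length = k ∧ s = b ++ t ∧ r = b ++ t' ∧ p.act t = some t' := by
  constructor
  · intro h
    have hk : k ≤ s.length := by
      by_contra! hk
      simp [p.actAt_of_length_lt hk] at h
    obtain ⟨b, t, rfl, rfl⟩ : ∃ b t : List α, s = b ++ t ∧ b.length = k :=
      ⟨s.take k, s.drop k, (List.take_append_drop k s).symm, by simpa using hk⟩
    rw [actAt_length, Option.map_eq_some_iff] at h
    obtain ⟨t', ht, rfl⟩ := h
    exact ⟨b, t, t', rfl, rfl, rfl, ht⟩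
  · rintro ⟨b, t, t', rfl, rfl, rfl, ht⟩
    rw [actAt_length, ht, Option.map_some]

theorem Piece.actAt_death_eq_some_iff {k : ℕ} {s r : List α} :
    (death : Piece κ α).actAt k s = some r ↔
      ∃ b x t, b.length = k ∧ s = b ++ x :: rev x :: t ∧ r = b ++ t := by
  rw [actAt_eq_some_iff]
  constructor
  · rintro ⟨b, _ | ⟨x, _ | ⟨y, t⟩⟩, t', hb, rfl, rfl, h⟩ <;>
      simp only [act, Option.ite_none_right_eq_some, Option.some.injEq, reduceCtorEq] at h
    obtain ⟨rfl, rfl⟩ := h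
    exact ⟨b, x, t, hb, rfl, rfl⟩
  · rintro ⟨b, x, t, hb, rfl, rfl⟩
    exact ⟨b, _, t, hb, rfl, rfl, by simp [act]⟩

theorem Piece.actAt_cross_eq_some_iff {c : κ} {k : ℕ} {s r : List α} :
    (cross c : Piece κ α).actAt k s = some r ↔
      ∃ b x y t, b.length = k ∧ s = b ++ x :: y :: t ∧ r = b ++ y :: x :: t := by
  rw [actAt_eq_some_iff]
  constructor
  · rintro ⟨b, _ | ⟨x, _ | ⟨y, t⟩⟩, t', hb, rfl, rfl, h⟩ <;>
      simp only [act, Option.some.injEq, reduceCtorEq] at h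
    exact ⟨b, x, y, t, hb, rfl, by rw [h]⟩
  · rintro ⟨b, x, y, t, hb, rfl, rfl⟩
    exact ⟨b, _, _, hb, rfl, rfl, rfl⟩

theorem Piece.actAt_nil_eq_some_iff {p : Piece κ α} {k : ℕ} {r : List α} :
    p.actAt k [] = some r ↔ k = 0 ∧ ∃ o, p = birth o ∧ r = [o, rev o] := by
  cases k <;> cases p <;> simp [actAt, act, eq_comm]

theorem Piece.actAt_eq_some_nil_iff {p : Piece κ α} {k : ℕ} {s : List α} :
    p.actAt k s = some [] ↔ k = 0 ∧ p = death ∧ ∃ x, s = [x, rev x] := by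
  rcases k with _ | k <;> rcases p with o | _ | c <;> rcases s with _ | ⟨x, _ | ⟨y, s⟩⟩ <;>
    simp [actAt, act, and_comm]

theorem Word.run_append_eq_some_iff {w w' : Word κ α} {s r : List α} :
    run (w ++ w') s = some r ↔ ∃ t, run w s = some t ∧ run w' t = some r := by
  rw [run_append, Option.bind_eq_some_iff]

theorem Word.run_cons_eq_some_iff {k : ℕ} {p : Piece κ α} {w : Word κ α} {s r : List α} :
    run ((k, p) :: w) s = some r ↔ ∃ t, p.actAt k s = some t ∧ run w t = some r :=
  Option.bind_eq_some_iff

theorem Word.run_context {u v x y : Word κ α} {s : List α} (hu : run u [] = some s)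
    (h : run x s = run y s) : run (u ++ x ++ v) [] = run (u ++ y ++ v) [] := by
  simp only [run_append, hu, Option.bind_some, h]

theorem Piece.act_bind_actAt (e f : Piece κ α) (m : ℕ) (t : List α) :
    (e.act t).bind (f.actAt (e.outs + m)) = (f.actAt (e.ins + m) t).bind e.act := by
  have above_two (x y : α) (r : List α) :
      f.actAt (2 + m) (x :: y :: r) = (f.actAt m r).map ([x, y] ++ ·) :=
    f.actAt_length_add [x, y] r m
  have fails (t : List α) (h : t.length < 2) : f.actAt (2 + m) t = none :=
    f.actAt_of_length_lt (by omega)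
  rcases e with o | _ | c
  · cases h : f.actAt m t <;> simp [outs, ins, act, above_two, h]
  all_goals rcases t with _ | ⟨x, _ | ⟨y, t⟩⟩
  any_goals simp [outs, ins, act, fails]
  · by_cases hy : y = rev x <;> cases h : f.actAt m t <;> simp [act, above_two, hy, h]
  · cases h : f.actAt m t <;> simp [act, above_two, h]

theorem Word.run_far (e f : Piece κ α) (k m : ℕ) (s : List α) :
    run [(k, e), (k + e.outs + m, f)] s = run [(k + e.ins + m, f), (k, e)] s := by
  rcases lt_or_ge s.length k with hk | hk
  · simp only [run, e.actAt_of_length_lt hk,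
      f.actAt_of_length_lt (show s.length < k + e.ins + m by omega), Option.bind_none]
  obtain ⟨b, t, rfl, rfl⟩ : ∃ b t : List α, s = b ++ t ∧ b.length = k :=
    ⟨s.take k, s.drop k, (List.take_append_drop k s).symm, by simpa using hk⟩
  simpa only [run, Option.bind_fun_some, add_assoc, Piece.actAt_length, Piece.actAt_length_add,
    Option.bind_map, Option.map_bind, Function.comp_def] using
    congrArg (Option.map (b ++ ·)) (Piece.act_bind_actAt e f m t)

theorem Word.run_reidemeister3 (c : κ) (k : ℕ) (s : List α) :
    run [(k, .cross c), (k + 1, .cross c), (k, .cross c)] s =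
      run [(k + 1, .cross c), (k, .cross c), (k + 1, .cross c)] s := by
  rcases lt_or_ge s.length k with hk | hk
  · simp only [run, Piece.actAt_of_length_lt _ hk,
      Piece.actAt_of_length_lt _ (hk.trans k.lt_succ_self), Option.bind_none]
  obtain ⟨b, t, rfl, rfl⟩ : ∃ b t : List α, s = b ++ t ∧ b.length = k :=
    ⟨s.take k, s.drop k, (List.take_append_drop k s).symm, by simpa using hk⟩
  rcases t with _ | ⟨x, _ | ⟨y, _ | ⟨z, t⟩⟩⟩ <;>
    simp [-List.append_nil, run, Piece.actAt_length, Piece.actAt_length_add, Piece.actAt, Piece.act]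

/-! ### Isotopies of tangles -/

/-- Regular isotopy of words that start at the strands `s`.  Every elementary step is a local move
`p → q` inside a larger word; the two words are required to have the same effect on `s`, so that
replacing one by the other preserves closedness. -/
inductive TangleIsotopic (s : List α) : Word Bool α → Word Bool α → Prop
  | move (c d : Word Bool α) {p q : Word Bool α} (h : LocalMove p q)
      (hrun : run (c ++ p ++ d) s = run (c ++ q ++ d) s) :
      TangleIsotopic s (c ++ p ++ d) (c ++ q ++ d)
  | refl (x : Word Bool α) : TangleIsotopic s x x
  | symm {x y : Word Bool α} : TangleIsotopic s x y → TangleIsotopic s y x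
  | trans {x y z : Word Bool α} :
      TangleIsotopic s x y → TangleIsotopic s y z → TangleIsotopic s x z

namespace TangleIsotopic

variable {s b t : List α} {x y o : α}

instance : Trans (TangleIsotopic s) (TangleIsotopic s) (TangleIsotopic s) := ⟨.trans⟩

theorem far (c d : Word Bool α) (e f : Piece Bool α) (k m : ℕ) :
    TangleIsotopic s (c ++ [(k, e), (k + e.outs + m, f)] ++ d)
      (c ++ [(k + e.ins + m, f), (k, e)] ++ d) :=
  .move c d (.far e f k m) (by simp only [run_append, funext (run_far e f k m)])

attribute [local simp] run Piece.actAt_length Piece.actAt_length_add Piece.actAt Piece.act rev_rev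

theorem curl_death :
    TangleIsotopic (b ++ x :: rev x :: t)
      [(b.length, .cross true), (b.length, .death)]
      [(b.length + 2, .birth (rev x)), (b.length + 1, .cross false), (b.length + 2, .death),
        (b.length, .death)] := by
  set k := b.length
  set s := b ++ x :: rev x :: t
  calc [(k, .cross true), (k, .death)]
    TangleIsotopic s _ [(k, .cross true), (k + 2, .birth (rev x)), (k + 1, .death), (k, .death)] :=
        (move [(k, .cross true)] [(k, .death)] (.zagzig (k + 1) (rev x))
          (by simp [s, k, add_assoc])).symm
    TangleIsotopic s _ [(k + 2, .birth (rev x)), (k, .cross true), (k + 1, .death), (k, .death)] :=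
        far [] [(k + 1, .death), (k, .death)] (.cross true) (.birth (rev x)) k 0
    TangleIsotopic s _ [(k + 2, .birth (rev x)), (k + 1, .cross false), (k, .death), (k, .death)] :=
        (move [(k + 2, .birth (rev x))] [(k, .death)] (.slideDeath k false) (by simp [s, k])).symm
    TangleIsotopic s _
        [(k + 2, .birth (rev x)), (k + 1, .cross false), (k + 2, .death), (k, .death)] :=
        far [(k + 2, .birth (rev x)), (k + 1, .cross false)] [] .death .death k 0

theorem curl_birth :
    TangleIsotopic (b ++ t)
      [(b.length, .birth o), (b.length, .cross true)]
      [(b.length, .birth (rev o)), (b.length + 2, .birth o), (b.length + 1, .cross false),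
        (b.length + 2, .death)] := by
  set k := b.length
  set s := b ++ t
  calc [(k, .birth o), (k, .cross true)]
    TangleIsotopic s _
        [(k, .birth o), (k + 1, .birth (rev o)), (k + 2, .death), (k, .cross true)] :=
        (move [(k, .birth o)] [(k, .cross true)] (.zigzag (k + 1) (rev o))
          (by simp [s, k, add_assoc])).symm
    TangleIsotopic s _
        [(k, .birth o), (k + 1, .birth (rev o)), (k, .cross true), (k + 2, .death)] :=
        (far [(k, .birth o), (k + 1, .birth (rev o))] [] (.cross true) .death k 0).symm
    TangleIsotopic s _
        [(k, .birth o), (k, .birth (rev o)), (k + 1, .cross false), (k + 2, .death)] :=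
        (move [(k, .birth o)] [(k + 2, .death)] (.slideBirth k (rev o) false) (by simp [s, k])).symm
    TangleIsotopic s _
        [(k, .birth (rev o)), (k + 2, .birth o), (k + 1, .cross false), (k + 2, .death)] :=
        (far [] [(k + 1, .cross false), (k + 2, .death)] (.birth (rev o)) (.birth o) k 0).symm

theorem cross_cross_death :
    TangleIsotopic (b ++ o :: x :: rev x :: t)
      [(b.length, .cross true), (b.length + 1, .cross true), (b.length, .death)]
      [(b.length + 1, .death)] := by
  set k := b.length
  set s := b ++ o :: x :: rev x :: t
  calc [(k, .cross true), (k + 1, .cross true), (k, .death)]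
    TangleIsotopic s _ [(k, .cross true), (k, .cross false), (k + 1, .death)] :=
        move [(k, .cross true)] [] (.slideDeath k true) (by simp [s, k])
    TangleIsotopic s _ [(k + 1, .death)] :=
        move [] [(k + 1, .death)] (.reidemeister2 k true) (by simp [s, k])

theorem circle_below :
    TangleIsotopic (b ++ x :: t)
      [(b.length, .birth o), (b.length, .death)]
      [(b.length + 1, .birth o), (b.length + 1, .death)] := by
  set k := b.length
  set s := b ++ x :: t
  calc [(k, .birth o), (k, .death)]
    TangleIsotopic s _ [(k, .birth o), (k + 1, .cross true), (k + 1, .cross false), (k, .death)] :=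
        (move [(k, .birth o)] [(k, .death)] (.reidemeister2 (k + 1) true) (by simp [s, k])).symm
    TangleIsotopic s _ [(k + 1, .birth o), (k, .cross false), (k + 1, .cross false), (k, .death)] :=
        move [] [(k + 1, .cross false), (k, .death)] (.slideBirth k o true) (by simp [s, k])
    TangleIsotopic s _ [(k + 1, .birth o), (k, .cross false), (k, .cross true), (k + 1, .death)] :=
        move [(k + 1, .birth o), (k, .cross false)] [] (.slideDeath k false) (by simp [s, k])
    TangleIsotopic s _ [(k + 1, .birth o), (k + 1, .death)] :=
        move [(k + 1, .birth o)] [(k + 1, .death)] (.reidemeister2 k false) (by simp [s, k])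

theorem circle_far (p : Piece Bool α) (k m : ℕ) :
    TangleIsotopic s
      [(k, p), (k + p.outs + m, .birth o), (k + p.outs + m, .death)]
      [(k + p.ins + m, .birth o), (k + p.ins + m, .death), (k, p)] :=
  .trans (far [] [(k + p.outs + m, .death)] p (.birth o) k m)
    (far [(k + p.ins + m, .birth o)] [] p .death k m)

theorem cut_and_rejoin (h : rev x = x) :
    TangleIsotopic (b ++ x :: t)
      [(b.length + 1, .birth x), (b.length, .death), (b.length, .birth (rev x)),
        (b.length + 1, .death)]
      [] := by
  set k := b.length
  set s := b ++ x :: t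
  calc [(k + 1, .birth x), (k, .death), (k, .birth (rev x)), (k + 1, .death)]
    TangleIsotopic s _ [(k, .birth (rev x)), (k + 1, .death)] :=
        move [] [(k, .birth (rev x)), (k + 1, .death)] (.zagzig k x) (by simp [s, k, h])
    TangleIsotopic s _ [] := move [] [] (.zigzag k (rev x)) (by simp [s, k, h])

end TangleIsotopic

/-! ### Skein invariants -/

theorem aPow_mul (m n : ℤ) : aPow m * aPow n = aPow (m + n) :=
  (LaurentPolynomial.T_add m n).symm

theorem aPow_zero : aPow 0 = 1 := LaurentPolynomial.T_zero

theorem zPow_neg_mul (n : ℤ) : zPow (-n) * zPow n = 1 := by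
  simp only [zPow, ← map_mul, ← LaurentPolynomial.T_add, neg_add_cancel, LaurentPolynomial.T_zero,
    map_one]

/-- The value of an invariant of diagrams on a word; words that are not closed get the value `0`, so
that the relations below hold without closedness assumptions. -/
def Word.val (F : LinkDiagram α → Laurent2) (w : Word Bool α) : Laurent2 :=
  if h : run w [] = some [] then F ⟨w, h⟩ else 0

theorem Word.val_of_closed {F : LinkDiagram α → Laurent2} {w : Word Bool α}
    (h : run w [] = some []) : val F w = F ⟨w, h⟩ := dif_pos h

theorem Word.val_of_not_closed {F : LinkDiagram α → Laurent2} {w : Word Bool α}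
    (h : run w [] ≠ some []) : val F w = 0 := dif_neg h

/-- The value of a circle split off from the rest of the diagram; `o` is its orientation, and
`rev o = o` holds for unoriented circles. -/
def circleValue (o : α) : Laurent2 :=
  (aPow 1 - aPow (-1)) * zPow (-1) + if rev o = o then 1 else 0

theorem circleValue_rev (o : α) : circleValue (rev o) = circleValue o := by
  simp only [circleValue, rev_rev, @eq_comm α o]

/-- The common form of the defining relations of `R` and `D`.  In the skein relation the vertical
smoothing is present when the strands are opposite, the horizontal one when they are parallel;
unoriented strands are both. -/
structure IsSkeinInvariant (F : LinkDiagram α → Laurent2) : Prop where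
  eq_or_eq_rev : ∀ x y : α, y = x ∨ y = rev x
  regular : ∀ K L, RegularIsotopic K L → F K = F L
  empty : val F [] = 1
  circle : ∀ o : α, val F [(0, .birth o), (0, .death)] = circleValue o
  skein : ∀ (u v : Word Bool α) (b t : List α) (x y : α), run u [] = some (b ++ x :: y :: t) →
    val F (u ++ [(b.length, .cross true)] ++ v) - val F (u ++ [(b.length, .cross false)] ++ v) =
      zPow 1 * ((if y = rev x then
          val F (u ++ [(b.length, .death), (b.length, .birth (rev x))] ++ v) else 0) -
        if x = y then val F (u ++ v) else 0)
  kink : ∀ (c : Bool) (u x v : Word Bool α), Kink c x →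
    run (u ++ x ++ v) [] = some [] → run (u ++ v) [] = some [] →
    val F (u ++ x ++ v) = aPow (if c then -1 else 1) * val F (u ++ v)

theorem Word.run_cross (c : κ) (b t : List α) (x y : α) :
    run [(b.length, .cross c)] (b ++ x :: y :: t) = some (b ++ y :: x :: t) := by
  simp [run, Piece.actAt_length, Piece.act]

theorem Word.run_death_birth (b t : List α) (x : α) :
    run [(b.length, (.death : Piece κ α)), (b.length, .birth (rev x))] (b ++ x :: rev x :: t) =
      some (b ++ rev x :: x :: t) := by
  simp [run, Piece.actAt_length, Piece.act, rev_rev]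

theorem Word.run_horizontal_smoothing {u : Word κ α} {b t : List α} {x : α}
    (hu : run u [] = some (b ++ x :: x :: t)) (c : κ) (v : Word κ α) :
    run (u ++ [(b.length, .cross c)] ++ v) [] = run (u ++ v) [] := by
  simp only [run_append, hu, Option.bind_some, run_cross]

theorem Word.run_vertical_smoothing {u : Word κ α} {b t : List α} {x : α}
    (hu : run u [] = some (b ++ x :: rev x :: t)) (c : κ) (v : Word κ α) :
    run (u ++ [(b.length, .cross c)] ++ v) [] =
      run (u ++ [(b.length, .death), (b.length, .birth (rev x))] ++ v) [] :=
  run_context hu (by rw [run_cross, run_death_birth])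

theorem SkeinTriple.run_eq {w₁ w₂ w₀ : Word Bool Bool} (h : SkeinTriple w₁ w₂ w₀) :
    run w₁ [] = run w₀ [] ∧ run w₂ [] = run w₀ [] := by
  cases h with
  | parallel u v b t x hu =>
    exact ⟨run_horizontal_smoothing hu _ v, run_horizontal_smoothing hu _ v⟩
  | antiparallel u v b t x hu =>
    exact ⟨run_vertical_smoothing hu _ v, run_vertical_smoothing hu _ v⟩

theorem IsHomflyR.val_skein {R : LinkDiagram Bool → Laurent2} (hR : IsHomflyR R)
    {w₁ w₂ w₀ : Word Bool Bool} (h : SkeinTriple w₁ w₂ w₀) :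
    val R w₁ - val R w₂ = zPow 1 * val R w₀ := by
  obtain ⟨h₁, h₂⟩ := h.run_eq
  by_cases h₀ : run w₀ [] = some []
  · rw [val_of_closed h₀, val_of_closed (h₁.trans h₀), val_of_closed (h₂.trans h₀)]
    exact hR.skein _ _ _ h
  · rw [val_of_not_closed h₀, val_of_not_closed (h₁ ▸ h₀), val_of_not_closed (h₂ ▸ h₀)]
    simp

theorem IsHomflyR.isSkeinInvariant {R : LinkDiagram Bool → Laurent2} (hR : IsHomflyR R) :
    IsSkeinInvariant R where
  eq_or_eq_rev := by decide
  regular := hR.regular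
  empty := (val_of_closed rfl).trans (hR.empty _ rfl)
  circle o := by
    have closed : run [(0, (.birth o : Piece Bool Bool)), (0, .death)] [] = some [] := by
      cases o <;> rfl
    have value : val R [(0, .birth o), (0, .death)] = (aPow 1 - aPow (-1)) * zPow (-1) :=
      (val_of_closed closed).trans (hR.circle _ o rfl)
    rw [value, circleValue, if_neg (by cases o <;> decide), add_zero]
  skein u v b t x y hu := by
    have rev_ne : x ≠ rev x := by cases x <;> decide
    obtain rfl | rfl : y = x ∨ y = rev x := by cases x <;> cases y <;> decide
    · rw [if_neg rev_ne, if_pos rfl]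
      linear_combination -hR.val_skein (.parallel u v b t y hu)
    · rw [if_pos rfl, if_neg rev_ne]
      linear_combination hR.val_skein (.antiparallel u v b t x hu)
  kink c u x v hx h h' := by
    rw [val_of_closed h, val_of_closed h']
    exact hR.kink _ _ c u x v hx rfl rfl

theorem IsKauffmanD.val_skein {D : LinkDiagram Unit → Laurent2} (hD : IsKauffmanD D)
    {u : Word Bool Unit} {b t : List Unit} (hu : run u [] = some (b ++ () :: () :: t))
    (v : Word Bool Unit) :
    val D (u ++ [(b.length, .cross true)] ++ v) - val D (u ++ [(b.length, .cross false)] ++ v) =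
      zPow 1 * (val D (u ++ [(b.length, .death), (b.length, .birth ())] ++ v) -
        val D (u ++ v)) := by
  have hH (c : Bool) := run_horizontal_smoothing hu c v
  have hV := (run_vertical_smoothing hu true v).symm.trans (hH true)
  by_cases h₀ : run (u ++ v) [] = some []
  · rw [val_of_closed h₀, val_of_closed ((hH _).trans h₀), val_of_closed ((hH _).trans h₀)]
    rw [show val D _ = _ from val_of_closed (hV.trans h₀)]
    exact hD.skein _ _ _ _ u v b.length rfl rfl rfl rfl
  · rw [val_of_not_closed h₀, val_of_not_closed (hH _ ▸ h₀), val_of_not_closed (hH _ ▸ h₀)]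
    rw [show val D _ = _ from val_of_not_closed (hV ▸ h₀)]
    simp

theorem IsKauffmanD.isSkeinInvariant {D : LinkDiagram Unit → Laurent2} (hD : IsKauffmanD D) :
    IsSkeinInvariant D where
  eq_or_eq_rev _ _ := Or.inl rfl
  regular := hD.regular
  empty := (val_of_closed rfl).trans (hD.empty _ rfl)
  circle _ := (val_of_closed rfl).trans (hD.circle _ rfl)
  skein u v b t x y hu := by
    rw [if_pos rfl, if_pos rfl]
    exact hD.val_skein hu v
  kink c u x v hx h h' := by
    rw [val_of_closed h, val_of_closed h']
    exact hD.kink _ _ c u x v hx rfl rfl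

namespace IsSkeinInvariant

variable {F : LinkDiagram α → Laurent2} {u v : Word Bool α}
  {b t s : List α} {x y o : α}

theorem val_congr (hF : IsSkeinInvariant F) (hu : run u [] = some s) {p q : Word Bool α}
    (h : TangleIsotopic s p q) : val F (u ++ p ++ v) = val F (u ++ q ++ v) := by
  induction h with
  | move c d h hrun =>
    rename_i p q
    have e := run_context (v := v) hu hrun
    by_cases hc : run (u ++ (c ++ p ++ d) ++ v) [] = some []
    · rw [val_of_closed hc, val_of_closed (e ▸ hc)]
      exact hF.regular _ _ (.rel _ _ ⟨u ++ c, d ++ v, p, q, h, by simp, by simp⟩)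
    · rw [val_of_not_closed hc, val_of_not_closed (e ▸ hc)]
  | refl => rfl
  | symm _ ih => exact ih.symm
  | trans _ _ ih₁ ih₂ => exact ih₁.trans ih₂

theorem val_kink (hF : IsSkeinInvariant F) {c : Bool} {w : Word Bool α} (hw : Kink c w)
    (hu : run u [] = some s) (hs : run w s = some s) :
    val F (u ++ w ++ v) = aPow (if c then -1 else 1) * val F (u ++ v) := by
  have e : run (u ++ w ++ v) [] = run (u ++ v) [] := by
    simp only [run_append, hu, Option.bind_some, hs]
  by_cases hc : run (u ++ v) [] = some []
  · exact hF.kink c u w v hw (e.trans hc) hc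
  · rw [val_of_not_closed hc, val_of_not_closed (e ▸ hc), mul_zero]

attribute [local simp] Piece.actAt_length Piece.actAt_length_add Piece.actAt Piece.act rev_rev run

theorem val_curl_death (hF : IsSkeinInvariant F) (hu : run u [] = some (b ++ x :: rev x :: t)) :
    val F (u ++ [(b.length, .cross true), (b.length, .death)] ++ v) =
      aPow 1 * val F (u ++ [(b.length, .death)] ++ v) := by
  have curl := hF.val_kink (v := [(b.length, .death)] ++ v)
    (.above (c := false) (b.length + 1) (rev x)) hu (by simp [add_assoc])
  rw [hF.val_congr hu .curl_death]
  simp only [List.append_assoc, List.cons_append, List.nil_append] at curl ⊢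
  exact curl

theorem val_curl_birth (hF : IsSkeinInvariant F) (hu : run u [] = some (b ++ t)) :
    val F (u ++ [(b.length, .birth o), (b.length, .cross true)] ++ v) =
      aPow 1 * val F (u ++ [(b.length, .birth (rev o))] ++ v) := by
  have curl := hF.val_kink (u := u ++ [(b.length, .birth (rev o))]) (v := v)
    (.above (c := false) (b.length + 1) o) (s := b ++ rev o :: o :: t)
    (by simp [run_append, hu]) (by simp [add_assoc])
  rw [hF.val_congr hu .curl_birth]
  simp only [List.append_assoc, List.cons_append, List.nil_append] at curl ⊢
  exact curl

theorem val_double_cross (hF : IsSkeinInvariant F) (hu : run u [] = some (b ++ x :: y :: t)) :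
    val F (u ++ [(b.length, .cross true), (b.length, .cross true)] ++ v) =
      val F (u ++ v) + zPow 1 * ((if x = rev y then
          aPow 1 * val F (u ++ [(b.length, .death), (b.length, .birth (rev y))] ++ v) else 0) -
        if y = x then val F (u ++ [(b.length, .cross true)] ++ v) else 0) := by
  have skein := hF.skein (u ++ [(b.length, .cross true)]) v b t y x (by simp [run_append, hu])
  have cancel : val F (u ++ [(b.length, .cross true), (b.length, .cross false)] ++ v) =
      val F (u ++ [] ++ v) :=
    hF.val_congr hu (.move [] [] (.reidemeister2 b.length true) (by simp))
  have curl (h : x = rev y) := hF.val_curl_death (v := [(b.length, .birth (rev y))] ++ v)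
    (u := u) (b := b) (x := x) (t := t) (by rw [hu, h, rev_rev])
  simp only [List.append_assoc, List.cons_append, List.nil_append] at skein cancel curl ⊢
  by_cases hx : x = rev y
  · rw [if_pos hx, cancel, curl hx] at skein
    rw [if_pos hx]
    linear_combination skein
  · rw [if_neg hx, cancel] at skein
    rw [if_neg hx]
    linear_combination skein

theorem val_cusp_cross (hF : IsSkeinInvariant F) (hu : run u [] = some (b ++ x :: t)) :
    val F (u ++ [(b.length + 1, .birth o), (b.length, .cross true)] ++ v) =
      val F (u ++ [(b.length, .birth o), (b.length + 1, .cross true)] ++ v) -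
      zPow 1 * ((if x = o then val F (u ++ [(b.length + 1, .birth o)] ++ v) else 0) -
        if rev o = x then val F (u ++ [(b.length, .birth o)] ++ v) else 0) := by
  have skein := hF.skein (u ++ [(b.length, .birth o)]) v (b ++ [o]) t (rev o) x
    (by simp [run_append, hu])
  have slide : val F (u ++ [(b.length, .birth o), (b.length + 1, .cross false)] ++ v) =
      val F (u ++ [(b.length + 1, .birth o), (b.length, .cross true)] ++ v) :=
    hF.val_congr hu (.move [] [] (.slideBirth b.length o false) (by simp))
  have straighten (h : x = o) : val F (u ++ [(b.length, .birth o), (b.length + 1, .death)] ++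
      ([(b.length + 1, .birth o)] ++ v)) = val F (u ++ [] ++ ([(b.length + 1, .birth o)] ++ v)) :=
    hF.val_congr hu (.move [] [] (.zigzag b.length o) (by simp [h]))
  simp only [List.append_assoc, List.cons_append, List.nil_append, rev_rev, List.length_append,
    List.length_singleton] at skein slide straighten ⊢
  by_cases hx : x = o
  · rw [if_pos hx, slide, straighten hx] at skein
    rw [if_pos hx]
    linear_combination -skein
  · rw [if_neg hx, slide] at skein
    rw [if_neg hx]
    linear_combination -skein

/-! ### Split circles -/

theorem val_circle_rev (hF : IsSkeinInvariant F) (hu : run u [] = some (b ++ t)) :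
    val F (u ++ [(b.length, .birth (rev o)), (b.length, .death)] ++ v) =
      val F (u ++ [(b.length, .birth o), (b.length, .death)] ++ v) := by
  have left_curl := hF.val_curl_birth (o := o) (v := [(b.length, .death)] ++ v) hu
  have right_curl := hF.val_curl_death (u := u ++ [(b.length, .birth o)]) (b := b) (x := o) (t := t)
    (v := v) (by simp [run_append, hu])
  simp only [List.cons_append, List.nil_append, List.append_assoc] at left_curl right_curl ⊢
  exact (LaurentPolynomial.isUnit_T 1).mul_left_cancel (left_curl.symm.trans right_curl)

theorem val_circle_above_parallel (hF : IsSkeinInvariant F) (hu : run u [] = some (b ++ x :: t)) :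
    val F (u ++ [(b.length + 1, .birth x), (b.length + 1, .death)] ++ v) =
      circleValue x * val F (u ++ v) := by
  have skein := hF.skein (u ++ [(b.length + 1, .birth x)]) ([(b.length + 1, .death)] ++ v) b
    (rev x :: t) x x (by simp [run_append, hu])
  have curl (c : Bool) := hF.val_kink (v := v) (.above (c := c) b.length x) hu (by simp)
  have rejoin (h : rev x = x) := hF.val_congr (v := v) hu (TangleIsotopic.cut_and_rejoin h)
  have hz := zPow_neg_mul 1
  simp only [List.cons_append, List.nil_append, List.append_assoc] at skein curl rejoin ⊢
  simp only [curl, if_true, Bool.false_eq_true, if_false] at skein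
  unfold circleValue
  by_cases h : rev x = x
  · rw [if_pos h.symm, rejoin h] at skein
    rw [if_pos h]
    linear_combination zPow (-1) * skein + (val F (u ++ v) -
      val F (u ++ (b.length + 1, .birth x) :: (b.length + 1, .death) :: v)) * hz
  · rw [if_neg (Ne.symm h)] at skein
    rw [if_neg h]
    linear_combination zPow (-1) * skein -
      val F (u ++ (b.length + 1, .birth x) :: (b.length + 1, .death) :: v) * hz

theorem val_circle_above (hF : IsSkeinInvariant F) (hu : run u [] = some (b ++ x :: t)) :
    val F (u ++ [(b.length + 1, .birth o), (b.length + 1, .death)] ++ v) =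
      circleValue o * val F (u ++ v) := by
  obtain rfl | rfl := hF.eq_or_eq_rev x o
  · exact hF.val_circle_above_parallel hu
  · rw [circleValue_rev, ← hF.val_circle_above_parallel hu]
    simpa using hF.val_circle_rev (u := u) (v := v) (b := b ++ [x]) (t := t) (o := x) (by simpa)

theorem val_circle_of_ne_nil (hF : IsSkeinInvariant F) (hu : run u [] = some (b ++ t))
    (hne : b ++ t ≠ []) :
    val F (u ++ [(b.length, .birth o), (b.length, .death)] ++ v) =
      circleValue o * val F (u ++ v) := by
  rcases t with _ | ⟨x, t⟩
  · obtain rfl | ⟨b, x, rfl⟩ := List.eq_nil_or_concat' b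
    · simp at hne
    · simpa using hF.val_circle_above (v := v) (o := o) (b := b) (x := x) (t := [])
        (by simpa using hu)
  · rw [hF.val_congr hu .circle_below, hF.val_circle_above hu]

theorem val_circle_after (hF : IsSkeinInvariant F) {k m : ℕ} {p : Piece Bool α}
    (hu : run u [] = some (b ++ t)) (hne : b ++ t ≠ []) (hb : b.length = k + p.ins + m) :
    val F (u ++ [(k, p)] ++ [(k + p.outs + m, .birth o), (k + p.outs + m, .death)] ++ v) =
      circleValue o * val F (u ++ [(k, p)] ++ v) := by
  have moved := hF.val_congr (v := v) hu (TangleIsotopic.circle_far (o := o) p k m)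
  have split := hF.val_circle_of_ne_nil (v := [(k, p)] ++ v) (o := o) hu hne
  rw [← hb] at moved
  simp only [List.append_assoc, List.cons_append, List.nil_append] at moved split ⊢
  rw [moved, split]

theorem val_circle_before (hF : IsSkeinInvariant F) {k m : ℕ} {p : Piece Bool α}
    (hu : run u [] = some s) (hp : run (u ++ [(k, p)]) [] = some (b ++ t)) (hne : b ++ t ≠ [])
    (hb : b.length = k + p.outs + m) :
    val F (u ++ [(k + p.ins + m, .birth o), (k + p.ins + m, .death)] ++ ([(k, p)] ++ v)) =
      circleValue o * val F (u ++ [(k, p)] ++ v) := by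
  have moved := hF.val_congr (v := v) hu (TangleIsotopic.circle_far (o := o) p k m)
  have split := hF.val_circle_of_ne_nil (v := v) (o := o) hp hne
  rw [← hb] at moved
  simp only [List.append_assoc, List.cons_append, List.nil_append] at moved split ⊢
  rw [← moved, split]

/-- Without strands next to it, the circle is first moved across the neighbouring piece. -/
theorem val_circle_of_nil (hF : IsSkeinInvariant F) (hu : run u [] = some []) :
    val F (u ++ [(0, .birth o), (0, .death)] ++ v) = circleValue o * val F (u ++ v) := by
  obtain rfl | ⟨u, ⟨j, p⟩, rfl⟩ := List.eq_nil_or_concat' u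
  · rcases v with _ | ⟨⟨j, p⟩, v⟩
    · simp [hF.circle, hF.empty]
    by_cases hp : (p.actAt j ([] : List α)).isSome
    · obtain ⟨rfl, o', rfl, -⟩ := Piece.actAt_nil_eq_some_iff.1 (Option.some_get hp).symm
      exact hF.val_circle_before (k := 0) (p := .birth o') (m := 0) (b := [o', rev o']) (t := [])
        rfl rfl (by simp) rfl
    · have hp : p.actAt j ([] : List α) = none := by simpa using hp
      rw [val_of_not_closed (by simp [hp]), val_of_not_closed (by simp [hp]), mul_zero]
  · obtain ⟨s, hs, hp⟩ := run_append_eq_some_iff.1 hu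
    obtain ⟨rfl, rfl, x, rfl⟩ := Piece.actAt_eq_some_nil_iff.1 (by simpa using hp)
    exact hF.val_circle_after (k := 0) (p := .death) (m := 0) (b := [x, rev x]) (t := []) hs
      (by simp) rfl

theorem val_circle (hF : IsSkeinInvariant F) (hu : run u [] = some (b ++ t)) :
    val F (u ++ [(b.length, .birth o), (b.length, .death)] ++ v) =
      circleValue o * val F (u ++ v) := by
  by_cases hne : b ++ t = []
  · obtain ⟨rfl, rfl⟩ := List.append_eq_nil_iff.1 hne
    exact hF.val_circle_of_nil hu
  · exact hF.val_circle_of_ne_nil hu hne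

end IsSkeinInvariant

/-! ### Laurent polynomials without negative powers -/

/-- The Laurent polynomials that satisfy `IsGenuinePolynomial`. -/
def genuinePolynomials (A : Type) [CommRing A] : Subring A[T;T⁻¹] :=
  (Polynomial.toLaurent (R := A)).range

theorem T_natCast_mem_genuinePolynomials {A : Type} [CommRing A] (n : ℕ) :
    LaurentPolynomial.T n ∈ genuinePolynomials A :=
  ⟨Polynomial.X ^ n, Polynomial.toLaurent_X_pow n⟩

theorem C_mem_genuinePolynomials {A : Type} [CommRing A] (c : A) :
    LaurentPolynomial.C c ∈ genuinePolynomials A :=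
  ⟨Polynomial.C c, Polynomial.toLaurent_C c⟩

theorem aPow_one_mem : aPow 1 ∈ genuinePolynomials ℤ[T;T⁻¹] := T_natCast_mem_genuinePolynomials 1

theorem zPow_mem (n : ℤ) : zPow n ∈ genuinePolynomials ℤ[T;T⁻¹] := C_mem_genuinePolynomials _

theorem aPow_one_mul_circleValue_mem (o : α) :
    aPow 1 * circleValue o ∈ genuinePolynomials ℤ[T;T⁻¹] := by
  have expansion : aPow 1 * circleValue o =
      (aPow 1 * aPow 1 - 1) * zPow (-1) + aPow 1 * if rev o = o then 1 else 0 := by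
    have cancel : aPow 1 * aPow (-1) = 1 := by rw [aPow_mul]; exact aPow_zero
    unfold circleValue
    linear_combination (-zPow (-1)) * cancel
  rw [expansion]
  refine add_mem (mul_mem (sub_mem (mul_mem aPow_one_mem aPow_one_mem) (one_mem _)) (zPow_mem _))
    (mul_mem aPow_one_mem ?_)
  split_ifs
  · exact one_mem _
  · exact zero_mem _

end

/-! ### Values of skein invariants on fronts -/

section

variable {κ α : Type}

/-- The piece of a link diagram with the strand of positive slope over at crossings. -/
def Piece.rounded : Piece Unit α → Piece Bool α
  | .birth o => .birth o
  | .death => .death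
  | .cross _ => .cross true

/-- The link diagram of a front with both kinds of cusps rounded: the morsification without its
curls. -/
def Word.rounded (w : Word Unit α) : Word Bool α := w.map fun e => (e.1, e.2.rounded)

theorem Word.rounded_nil : rounded ([] : Word Unit α) = [] := rfl

theorem Word.rounded_cons (k : ℕ) (p : Piece Unit α) (w : Word Unit α) :
    rounded ((k, p) :: w) = (k, p.rounded) :: rounded w := rfl

theorem Word.rounded_append (u v : Word Unit α) : rounded (u ++ v) = rounded u ++ rounded v :=
  List.map_append

theorem Piece.outs_rounded (p : Piece Unit α) : p.rounded.outs = p.outs := by cases p <;> rfl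

theorem Piece.ins_rounded (p : Piece Unit α) : p.rounded.ins = p.ins := by cases p <;> rfl

/-- The number of right cusps, for a single piece. -/
def Piece.rightCusps : Piece κ α → ℕ
  | .death => 1
  | _ => 0

/-- The number of right cusps. -/
def Word.rightCusps (w : Word κ α) : ℕ := (w.map fun e => e.2.rightCusps).sum

theorem Word.rightCusps_nil : rightCusps ([] : Word κ α) = 0 := rfl

theorem Word.rightCusps_cons (k : ℕ) (p : Piece κ α) (w : Word κ α) :
    rightCusps ((k, p) :: w) = p.rightCusps + rightCusps w := rfl

theorem Word.rightCusps_append (u v : Word κ α) :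
    rightCusps (u ++ v) = rightCusps u + rightCusps v := by
  simp [rightCusps]

variable [DecidableEq α] [Direction α]

theorem Piece.act_rounded (p : Piece Unit α) (s : List α) : p.rounded.act s = p.act s := by
  rcases p with o | _ | c <;> rcases s with _ | ⟨x, _ | ⟨y, s⟩⟩ <;> rfl

theorem Piece.actAt_rounded (p : Piece Unit α) (k : ℕ) (s : List α) :
    p.rounded.actAt k s = p.actAt k s := by
  induction k generalizing s with
  | zero => exact p.act_rounded s
  | succ k ih => rcases s with _ | ⟨x, s⟩ <;> simp [Piece.actAt, ih]

theorem Word.run_rounded (w : Word Unit α) : run (rounded w) = run w := by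
  induction w with
  | nil => rfl
  | cons e w ih =>
    funext s
    change (e.2.rounded.actAt e.1 s).bind (run (rounded w)) = (e.2.actAt e.1 s).bind (run w)
    rw [ih, Piece.actAt_rounded]

/-- The value of a skein invariant on a front; each curl at a right cusp of the morsification has
been traded for a factor `a`. -/
def Word.frontVal (F : LinkDiagram α → Laurent2) (w : Word Unit α) : Laurent2 :=
  aPow (rightCusps w) * val F (rounded w)

/-- The value on the front is a polynomial in `a`; this holds by convention if the word is not
closed. -/
def Word.PolyValued (F : LinkDiagram α → Laurent2) (w : Word Unit α) : Prop :=
  frontVal F w ∈ genuinePolynomials ℤ[T;T⁻¹]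

theorem Word.polyValued_of_closed {F : LinkDiagram α → Laurent2} {w : Word Unit α}
    (h : run w [] = some [] → PolyValued F w) : PolyValued F w := by
  by_cases hw : run w [] = some []
  · exact h hw
  · rw [PolyValued, frontVal, val_of_not_closed (by rwa [run_rounded]), mul_zero]
    exact zero_mem _

theorem Word.frontVal_context (F : LinkDiagram α → Laurent2) (u x v : Word Unit α) :
    frontVal F (u ++ x ++ v) = aPow (rightCusps u + rightCusps v) *
      (aPow (rightCusps x) * val F (rounded u ++ rounded x ++ rounded v)) := by
  simp only [frontVal, rightCusps_append, rounded_append]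
  rw [← mul_assoc, aPow_mul]
  congr 2
  push_cast
  ring

theorem Word.frontVal_of_val_eq {F : LinkDiagram α → Laurent2} {u x y v : Word Unit α}
    {c : Laurent2} (h : val F (rounded u ++ rounded x ++ rounded v) =
      c * val F (rounded u ++ rounded y ++ rounded v)) (hxy : rightCusps y ≤ rightCusps x) :
    frontVal F (u ++ x ++ v) =
      aPow (rightCusps x - rightCusps y : ℕ) * c * frontVal F (u ++ y ++ v) := by
  obtain ⟨n, hn⟩ := Nat.exists_eq_add_of_le hxy
  rw [frontVal_context, frontVal_context, h, hn, Nat.add_sub_cancel_left, Nat.cast_add,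
    ← aPow_mul (rightCusps y)]
  ring

/-- If a word does not run, then neither does any word containing it, so that the relation `hval`
is only needed for words that run. -/
theorem Word.PolyValued.of_relation {F : LinkDiagram α → Laurent2} {u x y v : Word Unit α}
    {c : Laurent2} (h : PolyValued F (u ++ y ++ v)) (hxy : rightCusps y ≤ rightCusps x)
    (hc : aPow (rightCusps x - rightCusps y : ℕ) * c ∈ genuinePolynomials ℤ[T;T⁻¹])
    (hval : ∀ s r, run (rounded u) [] = some s → run x s = some r →
      val F (rounded u ++ rounded x ++ rounded v) =
        c * val F (rounded u ++ rounded y ++ rounded v)) :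
    PolyValued F (u ++ x ++ v) := by
  refine polyValued_of_closed fun closed => ?_
  obtain ⟨r, hr, -⟩ := run_append_eq_some_iff.1 closed
  obtain ⟨s, hs, hx⟩ := run_append_eq_some_iff.1 hr
  rw [PolyValued, frontVal_of_val_eq (hval s r (by rwa [run_rounded]) hx) hxy]
  exact mul_mem hc h

/-- Words that can be exchanged inside a front without changing the value of `F`. -/
def Word.FrontEquiv (F : LinkDiagram α → Laurent2) (x y : Word Unit α) : Prop :=
  ∀ u v, frontVal F (u ++ x ++ v) = frontVal F (u ++ y ++ v)

namespace Word.FrontEquiv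

variable {F : LinkDiagram α → Laurent2} {x y z : Word Unit α}

theorem trans (hxy : FrontEquiv F x y) (hyz : FrontEquiv F y z) : FrontEquiv F x z :=
  fun u v => (hxy u v).trans (hyz u v)

instance : Trans (FrontEquiv F) (FrontEquiv F) (FrontEquiv F) := ⟨trans⟩

theorem symm (h : FrontEquiv F x y) : FrontEquiv F y x := fun u v => (h u v).symm

theorem context (h : FrontEquiv F x y) (c d : Word Unit α) :
    FrontEquiv F (c ++ x ++ d) (c ++ y ++ d) := fun u v => by
  simpa only [List.append_assoc] using h (u ++ c) (d ++ v)

theorem polyValued_iff (h : FrontEquiv F x y) (u v : Word Unit α) :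
    PolyValued F (u ++ x ++ v) ↔ PolyValued F (u ++ y ++ v) := by
  rw [PolyValued, PolyValued, h u v]

end Word.FrontEquiv

namespace IsSkeinInvariant

variable {F : LinkDiagram α → Laurent2} {u v : Word Unit α} {k : ℕ} {o : α}

theorem frontEquiv_of_tangleIsotopic (hF : IsSkeinInvariant F) {x y : Word Unit α}
    (h : ∀ s, TangleIsotopic s (rounded x) (rounded y)) (hxy : rightCusps x = rightCusps y) :
    FrontEquiv F x y := fun u v => by
  rw [frontVal_context, frontVal_context, hxy]
  rcases hu : run (rounded u) [] with _ | s
  · rw [val_of_not_closed (by simp [run_append, hu]), val_of_not_closed (by simp [run_append, hu])]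
  · rw [hF.val_congr hu (h s)]

theorem frontEquiv_far (hF : IsSkeinInvariant F) (p q : Piece Unit α) (k m : ℕ) :
    FrontEquiv F [(k, p), (k + p.outs + m, q)] [(k + p.ins + m, q), (k, p)] := by
  refine hF.frontEquiv_of_tangleIsotopic (fun s => ?_) (by simp [rightCusps, add_comm])
  simpa only [Piece.outs_rounded, Piece.ins_rounded] using!
    TangleIsotopic.far (s := s) [] [] p.rounded q.rounded k m

theorem frontEquiv_reidemeister3 (hF : IsSkeinInvariant F) (k : ℕ) :
    FrontEquiv F [(k, .cross ()), (k + 1, .cross ()), (k, .cross ())]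
      [(k + 1, .cross ()), (k, .cross ()), (k + 1, .cross ())] :=
  hF.frontEquiv_of_tangleIsotopic
    (fun s => .move [] [] (.reidemeister3 k true) (run_reidemeister3 _ k s)) rfl

theorem polyValued_nil (hF : IsSkeinInvariant F) : PolyValued F [] := by
  simp [PolyValued, frontVal, rounded, hF.empty, rightCusps, aPow_zero, one_mem]

attribute [local simp] Piece.actAt_length Piece.actAt_length_add Piece.actAt Piece.act rev_rev run

theorem polyValued_zigzag (hF : IsSkeinInvariant F) (h : PolyValued F (u ++ v)) :
    PolyValued F (u ++ [(k, .birth o), (k + 1, .death)] ++ v) := by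
  refine .of_relation (y := []) (c := 1) (by simpa using h) (Nat.zero_le _)
    (by simpa [rightCusps, Piece.rightCusps] using aPow_one_mem) fun s r hu hs => ?_
  obtain ⟨q, hq, hr⟩ := run_cons_eq_some_iff.1 hs
  obtain ⟨b, t, -, rfl, rfl, rfl, ⟨⟩⟩ := Piece.actAt_eq_some_iff.1 hq
  obtain _ | ⟨x, t⟩ := t
  · simp at hr
  obtain rfl : x = o := by
    by_contra hx
    simp [hx] at hr
  rw [one_mul]
  exact hF.val_congr hu (.move [] [] (.zigzag b.length x) (by simp))

theorem polyValued_zagzig (hF : IsSkeinInvariant F) (h : PolyValued F (u ++ v)) :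
    PolyValued F (u ++ [(k + 1, .birth o), (k, .death)] ++ v) := by
  refine .of_relation (y := []) (c := 1) (by simpa using h) (Nat.zero_le _)
    (by simpa [rightCusps, Piece.rightCusps] using aPow_one_mem) fun s r hu hs => ?_
  obtain ⟨q, hq, hr⟩ := run_cons_eq_some_iff.1 hs
  obtain ⟨b, t, -, hb, rfl, rfl, ⟨⟩⟩ := Piece.actAt_eq_some_iff.1 hq
  obtain rfl | ⟨b, x, rfl⟩ := List.eq_nil_or_concat' b
  · simp at hb
  obtain rfl : b.length = k := by simpa using hb
  obtain rfl : o = rev x := by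
    by_contra hx
    simp [hx] at hr
  rw [one_mul]
  exact hF.val_congr hu (.move [] [] (.zagzig b.length (rev x)) (by simp))

theorem polyValued_circle (hF : IsSkeinInvariant F) (h : PolyValued F (u ++ v)) :
    PolyValued F (u ++ [(k, .birth o), (k, .death)] ++ v) := by
  refine .of_relation (y := []) (by simpa using h) (Nat.zero_le _)
    (aPow_one_mul_circleValue_mem o) fun s r hu hs => ?_
  obtain ⟨q, hq, -⟩ := run_cons_eq_some_iff.1 hs
  obtain ⟨b, t, -, rfl, rfl, -, -⟩ := Piece.actAt_eq_some_iff.1 hq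
  simpa [rounded, Piece.rounded] using hF.val_circle (v := rounded v) (o := o) hu

theorem polyValued_curl_death (hF : IsSkeinInvariant F)
    (h : PolyValued F (u ++ [(k, .death)] ++ v)) :
    PolyValued F (u ++ [(k, .cross ()), (k, .death)] ++ v) := by
  refine .of_relation h le_rfl (by simpa [rightCusps, Piece.rightCusps, aPow_zero]
    using aPow_one_mem) fun s r hu hs => ?_
  obtain ⟨q, hq, hr⟩ := run_cons_eq_some_iff.1 hs
  obtain ⟨b, x, y, t, rfl, rfl, rfl⟩ := Piece.actAt_cross_eq_some_iff.1 hq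
  obtain rfl : x = rev y := by
    by_contra hx
    simp [hx] at hr
  exact hF.val_curl_death (x := rev y) (by rw [hu, rev_rev])

theorem polyValued_curl_birth (hF : IsSkeinInvariant F)
    (h : PolyValued F (u ++ [(k, .birth (rev o))] ++ v)) :
    PolyValued F (u ++ [(k, .birth o), (k, .cross ())] ++ v) := by
  refine .of_relation h le_rfl (by simpa [rightCusps, Piece.rightCusps, aPow_zero]
    using aPow_one_mem) fun s r hu hs => ?_
  obtain ⟨q, hq, -⟩ := run_cons_eq_some_iff.1 hs
  obtain ⟨b, t, -, rfl, rfl, -, -⟩ := Piece.actAt_eq_some_iff.1 hq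
  exact hF.val_curl_birth hu

theorem polyValued_cross_cross_death (hF : IsSkeinInvariant F)
    (h : PolyValued F (u ++ [(k + 1, .death)] ++ v)) :
    PolyValued F (u ++ [(k, .cross ()), (k + 1, .cross ()), (k, .death)] ++ v) := by
  refine .of_relation (c := 1) h le_rfl (by simp [rightCusps, Piece.rightCusps, aPow_zero, one_mem])
    fun s r hu hs => ?_
  obtain ⟨q, hq, hr⟩ := run_cons_eq_some_iff.1 hs
  obtain ⟨b, o, x, t, rfl, rfl, rfl⟩ := Piece.actAt_cross_eq_some_iff.1 hq
  obtain _ | ⟨y, t⟩ := t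
  · simp at hr
  obtain rfl : y = rev x := by
    by_contra hx
    simp [hx] at hr
  rw [one_mul]
  exact hF.val_congr hu .cross_cross_death

theorem frontVal_double_cross (hF : IsSkeinInvariant F) {b t : List α} {x y : α}
    (hu : run u [] = some (b ++ x :: y :: t)) :
    frontVal F (u ++ [(b.length, .cross ()), (b.length, .cross ())] ++ v) =
      frontVal F (u ++ [] ++ v) + zPow 1 * ((if x = rev y then
          frontVal F (u ++ [(b.length, .death), (b.length, .birth (rev y))] ++ v) else 0) -
        if y = x then frontVal F (u ++ [(b.length, .cross ())] ++ v) else 0) := by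
  have relation := hF.val_double_cross (v := rounded v) (by rwa [← run_rounded] at hu)
  simp only [frontVal_context]
  simp only [rounded_nil, rounded_cons, Piece.rounded, rightCusps_nil, rightCusps_cons,
    Piece.rightCusps, List.append_nil, add_zero, Nat.cast_zero, Nat.cast_one, aPow_zero, one_mul]
  rw [relation]
  split_ifs <;> ring

theorem frontVal_cusp_cross (hF : IsSkeinInvariant F) {b t : List α} {x : α}
    (hu : run u [] = some (b ++ x :: t)) :
    frontVal F (u ++ [(b.length + 1, .birth o), (b.length, .cross ())] ++ v) =
      frontVal F (u ++ [(b.length, .birth o), (b.length + 1, .cross ())] ++ v) -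
      zPow 1 * ((if x = o then frontVal F (u ++ [(b.length + 1, .birth o)] ++ v) else 0) -
        if rev o = x then frontVal F (u ++ [(b.length, .birth o)] ++ v) else 0) := by
  have relation := hF.val_cusp_cross (o := o) (v := rounded v) (by rwa [← run_rounded] at hu)
  simp only [frontVal_context]
  simp only [rounded_nil, rounded_cons, Piece.rounded, rightCusps_nil, rightCusps_cons,
    Piece.rightCusps, add_zero, Nat.cast_zero, aPow_zero, one_mul]
  rw [relation]
  split_ifs <;> ring

theorem polyValued_double_cross (hF : IsSkeinInvariant F) (h : PolyValued F (u ++ v))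
    (h_cross : PolyValued F (u ++ [(k, .cross ())] ++ v))
    (h_death : ∀ o, PolyValued F (u ++ [(k, .death), (k, .birth o)] ++ v)) :
    PolyValued F (u ++ [(k, .cross ()), (k, .cross ())] ++ v) := by
  refine polyValued_of_closed fun closed => ?_
  obtain ⟨r, hr, -⟩ := run_append_eq_some_iff.1 closed
  obtain ⟨s, hs, hx⟩ := run_append_eq_some_iff.1 hr
  obtain ⟨q, hq, -⟩ := run_cons_eq_some_iff.1 hx
  obtain ⟨b, x, y, t, rfl, rfl, -⟩ := Piece.actAt_cross_eq_some_iff.1 hq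
  rw [PolyValued, hF.frontVal_double_cross hs, List.append_nil]
  refine add_mem h (mul_mem (zPow_mem 1) (sub_mem ?_ ?_))
  · split_ifs
    exacts [h_death (rev y), zero_mem _]
  · split_ifs
    exacts [h_cross, zero_mem _]

/-- A left cusp can be moved past a neighbouring strand, up to fronts with fewer crossings. -/
theorem polyValued_cusp_cross_iff (hF : IsSkeinInvariant F)
    (h_above : PolyValued F (u ++ [(k + 1, .birth o)] ++ v))
    (h_below : PolyValued F (u ++ [(k, .birth o)] ++ v)) :
    PolyValued F (u ++ [(k + 1, .birth o), (k, .cross ())] ++ v) ↔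
      PolyValued F (u ++ [(k, .birth o), (k + 1, .cross ())] ++ v) := by
  have of_run {b t : List α} {x : α} (hb : b.length = k) (hu : run u [] = some (b ++ x :: t)) :
      PolyValued F (u ++ [(k + 1, .birth o), (k, .cross ())] ++ v) ↔
        PolyValued F (u ++ [(k, .birth o), (k + 1, .cross ())] ++ v) := by
    subst hb
    rw [PolyValued, PolyValued, hF.frontVal_cusp_cross hu, sub_eq_add_neg]
    refine add_mem_cancel_right (neg_mem <| mul_mem (zPow_mem 1) (sub_mem ?_ ?_))
    · split_ifs
      exacts [h_above, zero_mem _]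
    · split_ifs
      exacts [h_below, zero_mem _]
  constructor <;> refine fun h => polyValued_of_closed fun closed => ?_ <;>
    obtain ⟨r, hr, -⟩ := run_append_eq_some_iff.1 closed <;>
    obtain ⟨s, hs, hx⟩ := run_append_eq_some_iff.1 hr <;>
    obtain ⟨q, hq, hq'⟩ := run_cons_eq_some_iff.1 hx <;>
    obtain ⟨b, t, -, hb, rfl, rfl, ⟨⟩⟩ := Piece.actAt_eq_some_iff.1 hq
  · obtain _ | ⟨x, t⟩ := t
    · simp [← hb] at hq'
    · exact (of_run hb hs).1 h
  · obtain rfl | ⟨b, x, rfl⟩ := List.eq_nil_or_concat' b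
    · simp at hb
    · exact (of_run (by simpa using hb) (by simpa using hs)).2 h

end IsSkeinInvariant

end

/-! ### Left cusps moving to the right -/

section

variable {κ α : Type}

/-- The contribution of a piece to the complexity of a word. -/
@[simp]
def Piece.complexity : Piece κ α → ℕ
  | .birth _ => 1
  | .death => 0
  | .cross _ => 1

/-- The number of left cusps and crossings, which is the quantity that the reductions decrease. -/
def Word.complexity (w : Word κ α) : ℕ := (w.map fun e => e.2.complexity).sum

@[simp]
theorem Word.complexity_cons (k : ℕ) (p : Piece κ α) (w : Word κ α) :
    complexity ((k, p) :: w) = p.complexity + complexity w := List.sum_cons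

@[simp]
theorem Word.complexity_append (u v : Word κ α) :
    complexity (u ++ v) = complexity u + complexity v := by
  simp [complexity]

/-- The strand at height `k` crosses upward the `m` next strands. -/
def Word.rise (k m : ℕ) : Word Unit α := (List.range m).map fun i => (k + i, .cross ())

/-- The strand at height `k + m` crosses downward the `m` next strands. -/
def Word.fall (k m : ℕ) : Word Unit α := (rise k m).reverse

theorem Word.rise_succ (k m : ℕ) :
    (rise k (m + 1) : Word Unit α) = rise k m ++ [(k + m, .cross ())] := by
  simp [rise, List.range_succ]

theorem Word.rise_succ_left (k m : ℕ) :
    (rise k (m + 1) : Word Unit α) = (k, .cross ()) :: rise (k + 1) m := by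
  simp [rise, List.range_succ_eq_map, add_assoc, add_comm 1]

theorem Word.rise_add (k m n : ℕ) :
    (rise k (m + n) : Word Unit α) = rise k m ++ rise (k + m) n := by
  simp [rise, List.range_add, add_assoc]

theorem Word.rise_add_two_add (k i r : ℕ) : (rise k (i + 2 + r) : Word Unit α) =
    rise k i ++ [(k + i, .cross ()), (k + i + 1, .cross ())] ++ rise (k + i + 2) r := by
  rw [rise_add, rise_succ, rise_succ, List.append_assoc (rise k i)]
  rfl

theorem Word.fall_succ (k m : ℕ) :
    (fall k (m + 1) : Word Unit α) = (k + m, .cross ()) :: fall k m := by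
  simp [fall, rise_succ]

theorem Word.fall_succ_right (k m : ℕ) :
    (fall k (m + 1) : Word Unit α) = fall (k + 1) m ++ [(k, .cross ())] := by
  simp [fall, rise_succ_left]

@[simp]
theorem Word.complexity_rise (k m : ℕ) : complexity (rise k m : Word Unit α) = m := by
  simp [complexity, rise, Function.comp_def, Piece.complexity]

@[simp]
theorem Word.complexity_fall (k m : ℕ) : complexity (fall k m : Word Unit α) = m := by
  simp [complexity, fall, rise, Function.comp_def, Piece.complexity]

theorem Word.mem_rise {k m : ℕ} {e : ℕ × Piece Unit α} :
    e ∈ rise k m ↔ ∃ i < m, e = (k + i, .cross ()) := by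
  simp [rise, eq_comm]

/-- A left cusp at height `k` whose upper branch then crosses the `m` strands above it. -/
def Word.cuspRise (o : α) (k m : ℕ) : Word Unit α := (k, .birth o) :: rise (k + 1) m

/-- A left cusp at height `k + m` whose lower branch then crosses the `m` strands below it. -/
def Word.cuspFall (o : α) (k m : ℕ) : Word Unit α := (k + m, .birth o) :: fall k m

theorem Word.cuspRise_zero (o : α) (k : ℕ) : cuspRise o k 0 = [(k, .birth o)] := rfl

theorem Word.cuspRise_succ (o : α) (k m : ℕ) :
    cuspRise o k (m + 1) = cuspRise o k m ++ [(k + m + 1, .cross ())] := by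
  rw [cuspRise, rise_succ, add_right_comm]; rfl

theorem Word.cuspFall_succ_right (o : α) (k m : ℕ) :
    cuspFall o k (m + 1) = cuspFall o (k + 1) m ++ [(k, .cross ())] := by
  rw [cuspFall, fall_succ_right, ← add_assoc, add_right_comm]; rfl

@[simp]
theorem Word.complexity_cuspRise (o : α) (k m : ℕ) : complexity (cuspRise o k m) = m + 1 := by
  rw [cuspRise, complexity_cons, complexity_rise, Piece.complexity, add_comm]

@[simp]
theorem Word.complexity_cuspFall (o : α) (k m : ℕ) : complexity (cuspFall o k m) = m + 1 := by
  rw [cuspFall, complexity_cons, complexity_fall, Piece.complexity, add_comm]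

theorem Word.exists_last_birth (w : Word κ α) :
    (∀ e ∈ w, e.2.ins = 2) ∨
      ∃ u k o v, w = u ++ [(k, .birth o)] ++ v ∧ ∀ e ∈ v, e.2.ins = 2 := by
  induction w with
  | nil => exact .inl (by simp)
  | cons e w ih =>
    obtain no_birth | ⟨u, k, o, v, rfl, hv⟩ := ih
    · obtain ⟨k, o | _ | c⟩ := e
      · exact .inr ⟨[], k, o, w, rfl, no_birth⟩
      · exact .inl (List.forall_mem_cons.2 ⟨rfl, no_birth⟩)
      · exact .inl (List.forall_mem_cons.2 ⟨rfl, no_birth⟩)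
    · exact .inr ⟨e :: u, k, o, v, rfl, hv⟩

variable [DecidableEq α] [Direction α]

theorem Word.polyValued_append_cuspRise (F : LinkDiagram α → Laurent2) (u : Word Unit α) (o : α)
    (k m : ℕ) : PolyValued F (u ++ cuspRise o k m) := by
  refine polyValued_of_closed fun closed => ?_
  obtain _ | m := m
  · obtain ⟨s, -, hs⟩ := run_append_eq_some_iff.1 closed
    obtain ⟨r, hr, hnil⟩ := run_cons_eq_some_iff.1 hs
    obtain rfl : r = [] := by simpa [rise, run] using hnil
    simpa using (Piece.actAt_eq_some_nil_iff.1 hr).2.1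
  · rw [cuspRise_succ, ← List.append_assoc] at closed
    obtain ⟨s, -, hs⟩ := run_append_eq_some_iff.1 closed
    obtain ⟨r, hr, hnil⟩ := run_cons_eq_some_iff.1 hs
    obtain rfl : r = [] := by simpa [run] using hnil
    simpa using (Piece.actAt_eq_some_nil_iff.1 hr).2.1

namespace IsSkeinInvariant

variable {F : LinkDiagram α → Laurent2} {u v : Word Unit α} {j k m n : ℕ} {o : α}

theorem frontEquiv_far_above (hF : IsSkeinInvariant F) {y : Word Unit α}
    (hy : ∀ e ∈ y, e.2 = .cross () ∧ e.1 + 2 ≤ j) (p : Piece Unit α) :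
    FrontEquiv F (y ++ [(j, p)]) ((j, p) :: y) := by
  induction y with
  | nil => exact fun _ _ => rfl
  | cons e y ih =>
    obtain ⟨i, q⟩ := e
    obtain ⟨rfl, hi⟩ : q = .cross () ∧ i + 2 ≤ j := hy (i, q) List.mem_cons_self
    obtain ⟨m, rfl⟩ := Nat.exists_eq_add_of_le hi
    have past_tail := (ih fun e he => hy e (List.mem_cons_of_mem _ he)).context [(i, .cross ())] []
    have past_head := (hF.frontEquiv_far (.cross ()) p i m).context [] y
    simp only [List.append_nil] at past_tail
    exact past_tail.trans past_head

theorem frontEquiv_rise_far_above (hF : IsSkeinInvariant F) (p : Piece Unit α) (k m i : ℕ) :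
    FrontEquiv F (rise k m ++ [(k + m + 1 + i, p)]) ((k + m + 1 + i, p) :: rise k m) :=
  hF.frontEquiv_far_above (fun e he => by
    obtain ⟨l, hl, rfl⟩ := mem_rise.1 he
    exact ⟨rfl, by dsimp only; omega⟩) p

theorem frontEquiv_fall_far_above (hF : IsSkeinInvariant F) (p : Piece Unit α) (k m i : ℕ) :
    FrontEquiv F (fall k m ++ [(k + m + 1 + i, p)]) ((k + m + 1 + i, p) :: fall k m) :=
  hF.frontEquiv_far_above (fun e he => by
    obtain ⟨l, hl, rfl⟩ := mem_rise.1 (List.mem_reverse.1 he)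
    exact ⟨rfl, by dsimp only; omega⟩) p

theorem frontEquiv_rise_far_below (hF : IsSkeinInvariant F) (p : Piece Unit α) (j i m : ℕ) :
    FrontEquiv F (rise (j + p.ins + i) m ++ [(j, p)]) ((j, p) :: rise (j + p.outs + i) m) := by
  induction m generalizing i with
  | zero => exact fun _ _ => rfl
  | succ m ih =>
    have past_tail := (ih (i + 1)).context [(j + p.ins + i, .cross ())] []
    have past_head :=
      (hF.frontEquiv_far p (.cross ()) j i).symm.context [] (rise (j + p.outs + i + 1) m)
    simp only [List.append_nil] at past_tail
    rw [rise_succ_left, rise_succ_left]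
    exact past_tail.trans past_head

theorem frontEquiv_cuspRise_far_below (hF : IsSkeinInvariant F) {p : Piece Unit α}
    (hp : p.ins = 2) (j i m : ℕ) :
    FrontEquiv F (cuspRise o (j + 2 + i) m ++ [(j, p)])
      ((j, p) :: cuspRise o (j + p.outs + i) m) := by
  have past_rise :=
    (hF.frontEquiv_rise_far_below p j (i + 1) m).context [(j + 2 + i, .birth o)] []
  have past_birth :=
    (hF.frontEquiv_far p (.birth o) j i).symm.context [] (rise (j + p.outs + i + 1) m)
  simp only [List.append_nil, hp] at past_rise past_birth
  exact past_rise.trans past_birth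

theorem frontEquiv_cuspRise_far_above (hF : IsSkeinInvariant F) (p : Piece Unit α) (k i m : ℕ) :
    FrontEquiv F (cuspRise o k m ++ [(k + m + 2 + i, p)]) ((k + m + i, p) :: cuspRise o k m) := by
  have past_rise := (hF.frontEquiv_rise_far_above p (k + 1) m i).context [(k, .birth o)] []
  have past_birth := (hF.frontEquiv_far (.birth o) p k (m + i)).context [] (rise (k + 1) m)
  simp only [List.append_nil, Piece.outs, Piece.ins, add_zero, ← add_assoc,
    show k + 1 + m + 1 + i = k + m + 2 + i by omega,
    show k + 2 + m + i = k + m + 2 + i by omega] at past_rise past_birth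
  exact past_rise.trans past_birth

theorem frontEquiv_rise_cross (hF : IsSkeinInvariant F) (k i r : ℕ) :
    FrontEquiv F (rise k (i + 2 + r) ++ [(k + i, .cross ())])
      ((k + i + 1, .cross ()) :: rise k (i + 2 + r)) := by
  have past_tail := (hF.frontEquiv_rise_far_below (.cross ()) (k + i) 0 r).context
    (rise k i ++ [(k + i, .cross ()), (k + i + 1, .cross ())]) []
  have past_middle :=
    (hF.frontEquiv_reidemeister3 (k + i)).context (rise k i) (rise (k + i + 2) r)
  have past_head := (hF.frontEquiv_rise_far_above (.cross ()) k i 0).context []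
    ([(k + i, .cross ()), (k + i + 1, .cross ())] ++ rise (k + i + 2) r)
  rw [rise_add_two_add]
  simp only [List.append_assoc, List.cons_append, List.nil_append, List.append_nil, Piece.ins,
    Piece.outs, add_zero] at past_tail past_middle past_head ⊢
  exact past_tail.trans (past_middle.trans past_head)

theorem frontEquiv_cuspRise_cross (hF : IsSkeinInvariant F) (k i r : ℕ) :
    FrontEquiv F (cuspRise o k (i + 2 + r) ++ [(k + 1 + i, .cross ())])
      ((k + i, .cross ()) :: cuspRise o k (i + 2 + r)) := by
  have past_rise := (hF.frontEquiv_rise_cross (k + 1) i r).context [(k, .birth o)] []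
  have past_birth := (hF.frontEquiv_far (.birth o) (.cross ()) k i).context []
    (rise (k + 1) (i + 2 + r))
  simp only [List.append_nil, Piece.outs, Piece.ins, add_zero,
    show k + 1 + i + 1 = k + 2 + i by omega] at past_rise past_birth
  exact past_rise.trans past_birth

/-- Exchanging the cusp with the strands between its two possible positions produces fronts of lower
complexity only. -/
theorem polyValued_cuspRise_iff_cuspFall (hF : IsSkeinInvariant F)
    (ih : ∀ w, complexity w < n → PolyValued F w)
    (hn : complexity (u ++ cuspRise o k m ++ v) ≤ n) :
    PolyValued F (u ++ cuspRise o k m ++ v) ↔ PolyValued F (u ++ cuspFall o k m ++ v) := by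
  induction m generalizing v with
  | zero => rfl
  | succ m ihm =>
    have rise_to_fall := ihm (v := [(k + m + 1, .cross ())] ++ v) (by simp at hn ⊢; omega)
    have cross_first := ((hF.frontEquiv_fall_far_above (.cross ()) k m 0).context
      [(k + m, .birth o)] []).polyValued_iff u v
    have cusp_up := hF.polyValued_cusp_cross_iff (u := u) (v := fall k m ++ v) (k := k + m) (o := o)
      (ih _ (by simp at hn ⊢; omega)) (ih _ (by simp at hn ⊢; omega))
    rw [cuspRise_succ, cuspFall, fall_succ]
    simp only [cuspFall, List.append_assoc, List.cons_append, List.nil_append, ← add_assoc]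
      at rise_to_fall cross_first cusp_up ⊢
    rw [rise_to_fall, cross_first, cusp_up]

theorem polyValued_cuspRise_succ_iff (hF : IsSkeinInvariant F)
    (ih : ∀ w, complexity w < n → PolyValued F w)
    (hn : complexity (u ++ cuspRise o k (m + 1) ++ v) ≤ n) :
    PolyValued F (u ++ cuspRise o k (m + 1) ++ v) ↔
      PolyValued F (u ++ cuspFall o (k + 1) m ++ [(k, .cross ())] ++ v) := by
  rw [hF.polyValued_cuspRise_iff_cuspFall ih hn, cuspFall_succ_right, ← List.append_assoc u]

theorem polyValued_cuspRise_cross_below (hF : IsSkeinInvariant F)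
    (ih : ∀ w, complexity w < n → PolyValued F w)
    (hn : complexity (u ++ cuspRise o (k + 1) m ++ [(k, .cross ())] ++ v) ≤ n)
    (h : PolyValued F (u ++ cuspRise o k (m + 1) ++ v)) :
    PolyValued F (u ++ cuspRise o (k + 1) m ++ [(k, .cross ())] ++ v) := by
  rw [List.append_assoc _ _ v, hF.polyValued_cuspRise_iff_cuspFall ih (by simp at hn ⊢; omega),
    ← List.append_assoc]
  exact (hF.polyValued_cuspRise_succ_iff ih (by simp at hn ⊢; omega)).1 h

theorem polyValued_cuspRise_cross_bottom (hF : IsSkeinInvariant F)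
    (ih : ∀ w, complexity w < n → PolyValued F w)
    (hn : complexity (u ++ cuspRise o k m ++ [(k, .cross ())] ++ v) ≤ n) :
    PolyValued F (u ++ cuspRise o k m ++ [(k, .cross ())] ++ v) := by
  obtain _ | m := m
  · have curl := hF.polyValued_curl_birth (u := u) (v := v) (k := k) (o := o)
      (ih _ (by simp at hn ⊢; omega))
    simpa only [cuspRise_zero, List.append_assoc, List.cons_append, List.nil_append] using curl
  · rw [List.append_assoc _ _ v, hF.polyValued_cuspRise_succ_iff ih (by simp at hn ⊢; omega)]
    have double := hF.polyValued_double_cross (u := u ++ cuspFall o (k + 1) m) (v := v) (k := k)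
      (ih _ (by simp at hn ⊢; omega)) (ih _ (by simp at hn ⊢; omega))
      (fun o => ih _ (by simp at hn ⊢; omega))
    simpa only [List.append_assoc, List.cons_append, List.nil_append] using double

theorem polyValued_cuspRise_cross_top (hF : IsSkeinInvariant F)
    (ih : ∀ w, complexity w < n → PolyValued F w)
    (hn : complexity (u ++ cuspRise o k (m + 1) ++ [(k + m + 1, .cross ())] ++ v) ≤ n) :
    PolyValued F (u ++ cuspRise o k (m + 1) ++ [(k + m + 1, .cross ())] ++ v) := by
  have double := hF.polyValued_double_cross (u := u ++ cuspRise o k m) (v := v) (k := k + m + 1)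
    (ih _ (by simp at hn ⊢; omega)) (ih _ (by simp at hn ⊢; omega))
    (fun o => ih _ (by simp at hn ⊢; omega))
  simpa only [cuspRise_succ, List.append_assoc, List.cons_append, List.nil_append] using double

theorem polyValued_cuspRise_death_below (hF : IsSkeinInvariant F)
    (ih : ∀ w, complexity w < n → PolyValued F w)
    (hn : complexity (u ++ cuspRise o (k + 1) m ++ [(k, .death)] ++ v) ≤ n) :
    PolyValued F (u ++ cuspRise o (k + 1) m ++ [(k, .death)] ++ v) := by
  have death_first := ((hF.frontEquiv_rise_far_below .death k 0 m).context
    [(k + 1, .birth o)] []).polyValued_iff u v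
  have zagzig := hF.polyValued_zagzig (u := u) (v := rise k m ++ v) (k := k) (o := o)
    (ih _ (by simp at hn ⊢; omega))
  simp only [cuspRise, List.append_assoc, List.cons_append, List.nil_append, List.append_nil,
    Piece.ins, Piece.outs, add_zero] at death_first zagzig ⊢
  exact death_first.2 zagzig

theorem polyValued_cuspRise_death_bottom (hF : IsSkeinInvariant F)
    (ih : ∀ w, complexity w < n → PolyValued F w)
    (hn : complexity (u ++ cuspRise o k m ++ [(k, .death)] ++ v) ≤ n) :
    PolyValued F (u ++ cuspRise o k m ++ [(k, .death)] ++ v) := by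
  obtain _ | m := m
  · have circle := hF.polyValued_circle (u := u) (v := v) (k := k) (o := o)
      (ih _ (by simp at hn ⊢; omega))
    simpa only [cuspRise_zero, List.append_assoc, List.cons_append, List.nil_append] using circle
  · rw [List.append_assoc _ _ v, hF.polyValued_cuspRise_succ_iff ih (by simp at hn ⊢; omega)]
    have curl := hF.polyValued_curl_death (u := u ++ cuspFall o (k + 1) m) (v := v) (k := k)
      (ih _ (by simp at hn ⊢; omega))
    simpa only [List.append_assoc, List.cons_append, List.nil_append] using curl

theorem polyValued_cuspRise_death_between (hF : IsSkeinInvariant F) {i r : ℕ}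
    (ih : ∀ w, complexity w < n → PolyValued F w)
    (hn : complexity (u ++ cuspRise o k (i + 2 + r) ++ [(k + 1 + i, .death)] ++ v) ≤ n) :
    PolyValued F (u ++ cuspRise o k (i + 2 + r) ++ [(k + 1 + i, .death)] ++ v) := by
  have death_first := ((hF.frontEquiv_rise_far_below .death (k + 1 + i) 0 r).context
    ((k, .birth o) :: rise (k + 1) i ++ [(k + 1 + i, .cross ()), (k + 1 + i + 1, .cross ())])
    []).polyValued_iff u v
  have reduce := hF.polyValued_cross_cross_death (u := u ++ cuspRise o k i)
    (v := rise (k + 1 + i) r ++ v) (k := k + 1 + i) (ih _ (by simp at hn ⊢; omega))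
  rw [cuspRise, rise_add_two_add]
  simp only [cuspRise, List.append_assoc, List.cons_append, List.nil_append, List.append_nil,
    Piece.ins, Piece.outs, add_zero] at death_first reduce ⊢
  exact death_first.2 reduce

theorem polyValued_cuspRise_death_top (hF : IsSkeinInvariant F)
    (ih : ∀ w, complexity w < n → PolyValued F w)
    (hn : complexity (u ++ cuspRise o k (m + 1) ++ [(k + m + 1, .death)] ++ v) ≤ n) :
    PolyValued F (u ++ cuspRise o k (m + 1) ++ [(k + m + 1, .death)] ++ v) := by
  have curl := hF.polyValued_curl_death (u := u ++ cuspRise o k m) (v := v) (k := k + m + 1)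
    (ih _ (by simp at hn ⊢; omega))
  simpa only [cuspRise_succ, List.append_assoc, List.cons_append, List.nil_append] using curl

theorem polyValued_cuspRise_death_above (hF : IsSkeinInvariant F)
    (ih : ∀ w, complexity w < n → PolyValued F w)
    (hn : complexity (u ++ cuspRise o k m ++ [(k + m + 1, .death)] ++ v) ≤ n) :
    PolyValued F (u ++ cuspRise o k m ++ [(k + m + 1, .death)] ++ v) := by
  rw [List.append_assoc _ _ v, hF.polyValued_cuspRise_iff_cuspFall ih (by simp at hn ⊢; omega)]
  have death_first := ((hF.frontEquiv_fall_far_above .death k m 0).context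
    [(k + m, .birth o)] []).polyValued_iff u v
  have zigzag := hF.polyValued_zigzag (u := u) (v := fall k m ++ v) (k := k + m) (o := o)
    (ih _ (by simp at hn ⊢; omega))
  simp only [cuspFall, List.append_assoc, List.cons_append, List.nil_append, List.append_nil,
    add_zero] at death_first zigzag ⊢
  exact death_first.2 zigzag

theorem polyValued_cuspRise_death (hF : IsSkeinInvariant F)
    (ih : ∀ w, complexity w < n → PolyValued F w)
    (hn : complexity (u ++ cuspRise o k m ++ [(j, .death)] ++ v) ≤ n)
    (hkj : k ≤ j + 1) (hjm : j ≤ k + m + 1) :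
    PolyValued F (u ++ cuspRise o k m ++ [(j, .death)] ++ v) := by
  obtain rfl | hkj := hkj.eq_or_lt
  · exact hF.polyValued_cuspRise_death_below ih hn
  obtain rfl | hjm := hjm.eq_or_lt
  · exact hF.polyValued_cuspRise_death_above ih hn
  obtain rfl | hkj := (Nat.le_of_lt_succ hkj).eq_or_lt
  · exact hF.polyValued_cuspRise_death_bottom ih hn
  obtain ⟨i, rfl⟩ := Nat.exists_eq_add_of_le (show k + 1 ≤ j from hkj)
  obtain rfl | hjm := (show i + 1 ≤ m by omega).eq_or_lt
  · rw [add_right_comm] at hn ⊢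
    exact hF.polyValued_cuspRise_death_top ih hn
  · obtain ⟨r, rfl⟩ := Nat.exists_eq_add_of_le (show i + 2 ≤ m from hjm)
    exact hF.polyValued_cuspRise_death_between ih hn

theorem polyValued_cuspRise_cross (hF : IsSkeinInvariant F)
    (ih : ∀ w, complexity w < n → PolyValued F w)
    (ihv : ∀ {u : Word Unit α} {k m : ℕ},
      complexity (u ++ cuspRise o k m ++ v) ≤ n → PolyValued F (u ++ cuspRise o k m ++ v))
    (hn : complexity (u ++ cuspRise o k m ++ [(j, .cross ())] ++ v) ≤ n)
    (hkj : k ≤ j + 1) (hjm : j ≤ k + m + 1) :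
    PolyValued F (u ++ cuspRise o k m ++ [(j, .cross ())] ++ v) := by
  obtain rfl | hkj := hkj.eq_or_lt
  · exact hF.polyValued_cuspRise_cross_below ih hn (ihv (by simp at hn ⊢; omega))
  obtain rfl | hjm := hjm.eq_or_lt
  · rw [List.append_assoc u, ← cuspRise_succ] at hn ⊢
    exact ihv hn
  obtain rfl | hkj := (Nat.le_of_lt_succ hkj).eq_or_lt
  · exact hF.polyValued_cuspRise_cross_bottom ih hn
  obtain ⟨i, rfl⟩ := Nat.exists_eq_add_of_le (show k + 1 ≤ j from hkj)
  obtain rfl | hjm := (show i + 1 ≤ m by omega).eq_or_lt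
  · rw [add_right_comm] at hn ⊢
    exact hF.polyValued_cuspRise_cross_top ih hn
  · obtain ⟨r, rfl⟩ := Nat.exists_eq_add_of_le (show i + 2 ≤ m from hjm)
    have cross_first := (hF.frontEquiv_cuspRise_cross (o := o) k i r).polyValued_iff u v
    rw [List.append_assoc u, cross_first, List.append_cons]
    exact ihv (by simp at hn ⊢; omega)

/-- The cusp moves to the right until it takes part in a reduction. -/
theorem polyValued_cuspRise (hF : IsSkeinInvariant F) (ih : ∀ w, complexity w < n → PolyValued F w)
    (hv : ∀ e ∈ v, e.2.ins = 2) (hn : complexity (u ++ cuspRise o k m ++ v) ≤ n) :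
    PolyValued F (u ++ cuspRise o k m ++ v) := by
  induction v generalizing u k m with
  | nil => rw [List.append_nil]; exact polyValued_append_cuspRise ..
  | cons e v ihv =>
    obtain ⟨j, p⟩ := e
    have hp : p.ins = 2 := hv (j, p) List.mem_cons_self
    replace ihv {u : Word Unit α} {k m : ℕ} := ihv (u := u) (k := k) (m := m)
      fun e he => hv e (List.mem_cons_of_mem _ he)
    rw [List.append_cons] at hn ⊢
    rcases lt_or_ge k (j + 2) with hkj | hkj
    · rcases lt_or_ge j (k + m + 2) with hjm | hjm
      · obtain _ | _ | ⟨⟨⟩⟩ := p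
        · cases hp
        · exact hF.polyValued_cuspRise_death ih hn (by omega) (by omega)
        · exact hF.polyValued_cuspRise_cross ih ihv hn (by omega) (by omega)
      · obtain ⟨i, rfl⟩ := Nat.exists_eq_add_of_le hjm
        have past := (hF.frontEquiv_cuspRise_far_above (o := o) p k i m).polyValued_iff u v
        rw [List.append_assoc u, past, List.append_cons]
        exact ihv (by simp at hn ⊢; omega)
    · obtain ⟨i, rfl⟩ := Nat.exists_eq_add_of_le hkj
      have past := (hF.frontEquiv_cuspRise_far_below (o := o) hp j i m).polyValued_iff u v
      rw [List.append_assoc u, past, List.append_cons]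
      exact ihv (by simp at hn ⊢; omega)

/-- Rewriting starts from the last left cusp, so that none has to be moved past another one. -/
theorem polyValued (hF : IsSkeinInvariant F) (w : Word Unit α) : PolyValued F w := by
  induction hn : complexity w using Nat.strong_induction_on generalizing w with
  | _ n ih =>
    obtain no_birth | ⟨u, k, o, v, rfl, hv⟩ := exists_last_birth w
    · obtain _ | ⟨⟨k, p⟩, w⟩ := w
      · exact hF.polyValued_nil
      · refine polyValued_of_closed fun closed => ?_
        obtain ⟨r, hr, -⟩ := run_cons_eq_some_iff.1 closed
        obtain ⟨-, o, rfl, -⟩ := Piece.actAt_nil_eq_some_iff.1 hr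
        exact absurd (no_birth _ List.mem_cons_self) (by simp [Piece.ins])
    · exact hF.polyValued_cuspRise (k := k) (m := 0) (fun w hw => ih _ hw w rfl) hv hn.le

end IsSkeinInvariant

end

/-! ### Morsifications -/

variable {α : Type}

theorem Word.morsify_cons (k : ℕ) (p : Piece Unit α) (w : Word Unit α) :
    morsify ((k, p) :: w) = p.morsify k ++ morsify w := rfl

theorem Word.forget_morsify (w : Word Unit α) :
    (morsify w).forget = morsify w.forget := by
  induction w with
  | nil => rfl
  | cons e w ih =>
    obtain ⟨k, o | _ | c⟩ := e <;>
      simpa [morsify, Word.forget, Piece.morsify, Piece.forget] using ih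

variable [DecidableEq α] [Direction α]

theorem Front.forget_morsify (l : Front α) :
    ClosedWord.forget l.morsify = Front.morsify (ClosedWord.forget l) :=
  Subtype.ext (Word.forget_morsify l.1)

namespace IsSkeinInvariant

variable {F : LinkDiagram α → Laurent2}

theorem val_piece_morsify (hF : IsSkeinInvariant F) {u v : Word Bool α} {k : ℕ} {p : Piece Unit α}
    {s r : List α} (hu : run u [] = some s) (hp : p.actAt k s = some r) :
    val F (u ++ p.morsify k ++ v) = aPow p.rightCusps * val F (u ++ [(k, p.rounded)] ++ v) := by
  obtain o | _ | c := p
  · simp [Piece.morsify, Piece.rounded, Piece.rightCusps, aPow_zero]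
  · obtain ⟨b, x, t, rfl, rfl, rfl⟩ := Piece.actAt_death_eq_some_iff.1 hp
    simpa [Piece.morsify, Piece.rounded, Piece.rightCusps] using hF.val_curl_death (v := v) hu
  · simp [Piece.morsify, Piece.rounded, Piece.rightCusps, aPow_zero]

theorem val_morsify (hF : IsSkeinInvariant F) {u : Word Bool α} {w : Word Unit α} {s r : List α}
    (hu : run u [] = some s) (hw : run w s = some r) :
    val F (u ++ morsify w) = aPow (rightCusps w) * val F (u ++ rounded w) := by
  induction w generalizing u s with
  | nil => simp [morsify, rounded_nil, rightCusps_nil, aPow_zero]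
  | cons e w ih =>
    obtain ⟨k, p⟩ := e
    obtain ⟨s', hp, hw⟩ := run_cons_eq_some_iff.1 hw
    have hup : run (u ++ [(k, p.rounded)]) [] = some s' :=
      run_append_eq_some_iff.2 ⟨s, hu, by simp [run, Piece.actAt_rounded, hp]⟩
    rw [morsify_cons, rounded_cons, rightCusps_cons, ← List.append_assoc, List.append_cons u _,
      hF.val_piece_morsify hu hp, ih hup hw, ← mul_assoc, aPow_mul, Nat.cast_add]

theorem isGenuinePolynomial_morsify (hF : IsSkeinInvariant F) (l : Front α) :
    IsGenuinePolynomial (F l.morsify) := by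
  have value_eq : F l.morsify = frontVal F l.1 := by
    have value_morsify := hF.val_morsify (u := []) rfl l.2
    rwa [List.nil_append, val_of_closed (morsify_run l.1 [] [] l.2)] at value_morsify
  exact value_eq ▸ hF.polyValued l.1

end IsSkeinInvariant

theorem isGenuinePolynomial_homflyR (l : Front Bool) : IsGenuinePolynomial (homflyR l.morsify) := by
  unfold homflyR
  split_ifs with h
  · exact h.choose_spec.isSkeinInvariant.isGenuinePolynomial_morsify l
  · exact zero_mem (genuinePolynomials _)

theorem isGenuinePolynomial_kauffmanD (l : Front Unit) :
    IsGenuinePolynomial (kauffmanD l.morsify) := by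
  unfold kauffmanD
  split_ifs with h
  · exact h.choose_spec.isSkeinInvariant.isGenuinePolynomial_morsify l
  · exact zero_mem (genuinePolynomials _)

/-! ### States -/

theorem Word.cuspCount_append {u v : Word Unit Bool} {s r : List Bool} (hu : run u s = some r) :
    cuspCount (u ++ v) s = cuspCount u s + cuspCount v r := by
  induction u generalizing s with
  | nil =>
    obtain rfl : s = r := by simpa [run] using hu
    simp [cuspCount]
  | cons e u ih =>
    obtain ⟨k, p⟩ := e
    obtain ⟨s', hp, hu⟩ := run_cons_eq_some_iff.1 hu
    simp only [List.cons_append, cuspCount, hp, Option.getD_some, ih hu, add_assoc]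

theorem StatePiece.weight_horizontal_mem (s : List Bool) :
    weight .horizontal s ∈ genuinePolynomials (RatFunc ℚ) := by
  rcases s with _ | ⟨_ | _, _ | ⟨_ | _, s⟩⟩
  case cons.false.cons.true => exact C_mem_genuinePolynomials _
  all_goals exact zero_mem _

/-- The two new cusps of a vertical splicing with nonzero weight make up for the factor `a⁻²` in the
weight. -/
theorem StatePiece.T_cuspCount_mul_weight_vertical_mem {k : ℕ} {o : Bool} {s r : List Bool}
    (hs : run ((vertical o).target k) s = some r) :
    LaurentPolynomial.T (cuspCount ((vertical o).target k) s) * (vertical o).weight (s.drop k) ∈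
      genuinePolynomials (RatFunc ℚ) := by
  obtain ⟨s', hdeath, -⟩ := run_cons_eq_some_iff.1 hs
  obtain ⟨b, x, t, rfl, rfl, rfl⟩ := Piece.actAt_death_eq_some_iff.1 hdeath
  obtain _ | _ := o <;> obtain _ | _ := x
  · have two_cusps :
        cuspCount ((vertical false).target b.length) (b ++ false :: rev false :: t) = 2 := by
      simp [target, cuspCount]
    have weight_eq : (vertical false).weight (false :: rev false :: t) =
        LaurentPolynomial.C (tVar * (tVar - tVar⁻¹)) * LaurentPolynomial.T (-2) := rfl
    have cancel : (LaurentPolynomial.T 2 : (RatFunc ℚ)[T;T⁻¹]) * LaurentPolynomial.T (-2) = 1 := by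
      rw [← LaurentPolynomial.T_add, add_neg_cancel, LaurentPolynomial.T_zero]
    rw [two_cusps, List.drop_left, weight_eq, mul_left_comm, Nat.cast_ofNat, cancel, mul_one]
    exact C_mem_genuinePolynomials _
  all_goals
    rw [List.drop_left]
    simp [weight, rev, zero_mem]

theorem StatePiece.T_cuspCount_mul_weight_mem {p : StatePiece} {k : ℕ} {s r : List Bool}
    (hs : run (p.target k) s = some r) :
    LaurentPolynomial.T (cuspCount (p.target k) s) * p.weight (s.drop k) ∈
      genuinePolynomials (RatFunc ℚ) := by
  obtain o | _ | _ | _ | o := p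
  case horizontal =>
    exact mul_mem (T_natCast_mem_genuinePolynomials _) (weight_horizontal_mem _)
  case vertical => exact T_cuspCount_mul_weight_vertical_mem hs
  all_goals exact mul_mem (T_natCast_mem_genuinePolynomials _) (one_mem _)

theorem T_cuspCount_mul_weightProd_mem {w : List (ℕ × StatePiece)} {s r : List Bool}
    (hs : run (w.flatMap fun e => e.2.target e.1) s = some r) :
    LaurentPolynomial.T (cuspCount (w.flatMap fun e => e.2.target e.1) s) * weightProd w s ∈
      genuinePolynomials (RatFunc ℚ) := by
  induction w generalizing s with
  | nil => exact mul_mem (T_natCast_mem_genuinePolynomials _) (one_mem _)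
  | cons e w ih =>
    obtain ⟨k, p⟩ := e
    obtain ⟨s', hp, hw⟩ := run_append_eq_some_iff.1 hs
    rw [List.flatMap_cons, cuspCount_append hp, weightProd, hp, Option.getD_some, Nat.cast_add,
      LaurentPolynomial.T_add, mul_mul_mul_comm]
    exact mul_mem (StatePiece.T_cuspCount_mul_weight_mem hp) (ih hw)

theorem IsGenuinePolynomial.subst {f : Laurent2} (hf : IsGenuinePolynomial f) :
    IsGenuinePolynomial (Laurent2.subst f) := by
  obtain ⟨p, rfl⟩ := hf
  have subst_toLaurent : (Polynomial.toLaurent).comp (Polynomial.mapRingHom substZ) =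
      Laurent2.subst.comp Polynomial.toLaurent := by
    refine Polynomial.ringHom_ext (fun c => ?_) ?_
    · simp [Laurent2.subst]
    · simp only [RingHom.comp_apply, Polynomial.coe_mapRingHom, Polynomial.map_X,
        Polynomial.toLaurent_X, Laurent2.subst, LaurentPolynomial.eval₂_T, zpow_one]
  exact ⟨p.map substZ, congrArg (fun φ => φ p) subst_toLaurent⟩

theorem State.isGenuinePolynomial_contribution {l : Front Unit} (σ : State l) :
    IsGenuinePolynomial σ.contribution := by
  have cusp_factor : (LaurentPolynomial.C tVar⁻¹ * LaurentPolynomial.T 1) ^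
      cuspCount σ.front.1 [] = LaurentPolynomial.C (tVar⁻¹ ^ cuspCount σ.front.1 []) *
        LaurentPolynomial.T (cuspCount σ.front.1 []) := by
    rw [mul_pow, LaurentPolynomial.T_pow, mul_one, map_pow]
  rw [contribution, cusp_factor, mul_assoc (LaurentPolynomial.C _)]
  exact mul_mem (mul_mem (C_mem_genuinePolynomials _) (T_cuspCount_mul_weightProd_mem σ.closed))
    (isGenuinePolynomial_homflyR σ.front).subst

/-! ### The Bennequin invariant -/

theorem le_leastExponent_T_mul {A : Type} [Semiring A] {f : A[T;T⁻¹]}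
    (hf : IsGenuinePolynomial f) (n : ℤ) :
    (n : WithTop ℤ) ≤ leastExponent (LaurentPolynomial.T n * f) := by
  obtain ⟨p, rfl⟩ := hf
  refine Finset.le_min fun i hi => WithTop.coe_le_coe.2 ?_
  rw [Finsupp.mem_support_iff, LaurentPolynomial.T,
    AddMonoidAlgebra.coeff_single_mul_eq_mul_coeff (m₂ := i - n) (by intros; omega), one_mul,
    ← Finsupp.mem_support_iff, LaurentPolynomial.support_coeff_toLaurent] at hi
  obtain ⟨j, -, hj⟩ := Finset.mem_map.1 hi
  have j_add : (j : ℤ) = i - n := hj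
  omega

end

theorem mainTheorem2 (l : Front Bool) :
    (∀ σ : State l.forget, IsGenuinePolynomial σ.contribution) ∧
      IsGenuinePolynomial (kauffmanD (Front.morsify l.forget)) ∧
      (tb l : WithTop ℤ) ≤ eY l := by
  refine ⟨State.isGenuinePolynomial_contribution, isGenuinePolynomial_kauffmanD _, ?_⟩
  rw [eY, kauffmanY, Front.forget_morsify]
  exact le_leastExponent_T_mul (isGenuinePolynomial_kauffmanD _) (tb l)
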